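/- Let $n\in\mathbb{N}$, let $Y$ be a complex Banach space, $k\ge 0$, $w(x)=(1+\|x\|)^k$ for $x\in\mathbb{R}^n$, and let $X$ be one of $BUC(\mathbb{R}^n,Y)$ (bounded uniformly continuous functions, sup norm), $C_0(\mathbb{R}^n,Y)$ (continuous functions vanishing at infinity, sup norm), or $L^p(\mathbb{R}^n,Y)$ with $1\le p<\infty$. Let $wX=\{wg:g\in X\}$ with norm $\|f\|_{wX}=\|f/w\|_X$, and let $\Delta_{wX}$ be the distributional Laplacian with domain $D(\Delta_{wX})=\{f\in wX:\Delta f\in wX\}$. For $f\in wX$ put $G(0)f=f$ and $$(G(t)f)(x)=(4\pi t)^{-n/2}\int_{\mathbb{R}^n}f(x-y)\,e^{-\|y\|^2/4t}\,dy,\qquad t>0,\ x\in\mathbb{R}^n .$$ A mild solution of (a) $u'=\Delta_{wX}u$ on $[0,\infty)$ is a continuous $u:[0,\infty)\to wX$ such that, for all $t\ge0$, $\int_0^t u(s)\,ds\in D(\Delta_{wX})$ and $u(t)=u(0)+\Delta_{wX}\int_0^t u(s)\,ds$. Put $M=(0,\infty)\times\mathbb{R}^n$. A classical solution of the heat equation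 $$\text{(b)}\qquad \frac{\partial v}{\partial t}=\sum_{j=1}^n\frac{\partial^2 v}{\partial x_j^2}\quad\text{on } M$$ is a continuous function $v:M\to Y$ whose derivatives $\partial v/\partial t$, $\partial v/\partial x_j$, $\partial^2v/\partial x_j^2$ exist and are continuous on $M$ and which satisfies (b) at every point of $M$. 1. The mild solutions $u:[0,\infty)\to wX$ of (a) are exactly the functions $u(t)=G(t)f$ with $f\in wX$; here, for $t>0$, the integral defining $(G(t)f)(x)$ exists as a Bochner integral for every $x\in\mathbb{R}^n$, and $G(t)f\in wX$. 2. Each mild solution $u=G(\cdot)f$ is continuously differentiable from $(0,\infty)$ to $wX$ with $u(t)\in D(\Delta_{wX})$ and $u'(t)=\Delta_{wX}u(t)$ for $t>0$; the function $(t,x)\mapsto (G(t)f)(x)$ belongs to $C^\infty(M,Y)$ and is a classical solution of (b); and (c) $u(t)\to f$ in $wX$ as $t\to0^+$. 3. Conversely, let $v$ be a classical solution of (b) such that $v(t,\cdot)\in wX$ for all $t>0$, $\|v(t,\cdot)\|_{wX}$ is bounded for $t$ in each compact subinterval of $(0,\infty)$ (for example, $t\mapsto v(t,\cdot)$ is continuous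 from $(0,\infty)$ to $wX$), and $v(t,\cdot)\to f$ in $wX$ as $t\to0^+$ for some $f\in wX$. Then $u(0)=f$, $u(t)=v(t,\cdot)$ $(t>0)$ defines a mild solution of (a) on $[0,\infty)$. -/

import Mathlib

open MeasureTheory Set Filter Topology
open scoped ENNReal ContDiff BoundedContinuousFunction ZeroAtInfty

noncomputable section

namespace WeightedHeat

/-- Euclidean space `ℝⁿ`. -/
abbrev Rn (n : ℕ) : Type := EuclideanSpace ℝ (Fin n)

/-- The weight `w(x) = (1 + ‖x‖)ᵏ`. -/
def weight {n : ℕ} (k : ℝ) (x : Rn n) : ℝ := (1 + ‖x‖) ^ k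

/-- The admissible choices of the unweighted space `X`. -/
inductive SpaceKind : Type where
  /-- bounded uniformly continuous functions -/
  | buc : SpaceKind
  /-- continuous functions vanishing at infinity -/
  | c0 : SpaceKind
  /-- Bochner–Lebesgue space `Lᵖ`, `1 ≤ p < ∞` -/
  | lp (p : ℝ≥0∞) (one_le : 1 ≤ p) (ne_top : p ≠ ⊤) : SpaceKind

section Spaces

variable (n : ℕ) (Y : Type*) [NormedAddCommGroup Y] [NormedSpace ℂ Y]

/-- `BUC(ℝⁿ, Y)`, a subspace of the bounded continuous functions with the supremum norm. -/
def BUC : Submodule ℂ (Rn n →ᵇ Y) where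
  carrier := {g | UniformContinuous g}
  add_mem' := fun hf hg => UniformContinuous.add hf hg
  zero_mem' := uniformContinuous_const
  smul_mem' := fun c _ hf => UniformContinuous.const_smul hf c

/-- The Banach space `X`: one of `BUC(ℝⁿ, Y)`, `C₀(ℝⁿ, Y)`, `Lᵖ(ℝⁿ, Y)`. -/
def BaseSpace : SpaceKind → Type _
  | .buc => BUC n Y
  | .c0 => C₀(Rn n, Y)
  | .lp p _ _ => Lp Y p (volume : Measure (Rn n))

instance (κ : SpaceKind) : NormedAddCommGroup (BaseSpace n Y κ) :=
  match κ with
  | .buc => inferInstanceAs (NormedAddCommGroup (BUC n Y))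
  | .c0 => inferInstanceAs (NormedAddCommGroup C₀(Rn n, Y))
  | .lp p h _ =>
    haveI : Fact (1 ≤ p) := ⟨h⟩
    inferInstanceAs (NormedAddCommGroup (Lp Y p (volume : Measure (Rn n))))

instance (κ : SpaceKind) : NormedSpace ℂ (BaseSpace n Y κ) :=
  match κ with
  | .buc => inferInstanceAs (NormedSpace ℂ (BUC n Y))
  | .c0 => inferInstanceAs (NormedSpace ℂ C₀(Rn n, Y))
  | .lp p h _ =>
    haveI : Fact (1 ≤ p) := ⟨h⟩
    inferInstanceAs (NormedSpace ℂ (Lp Y p (volume : Measure (Rn n))))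

/-- The function on `ℝⁿ` underlying an element of `X` (for `Lᵖ`: a representative). -/
def BaseSpace.toFun {n : ℕ} {Y : Type*} [NormedAddCommGroup Y] [NormedSpace ℂ Y] :
    {κ : SpaceKind} → BaseSpace n Y κ → Rn n → Y
  | .buc, g => fun x => (show BUC n Y from g).1 x
  | .c0, g => fun x => (show C₀(Rn n, Y) from g) x
  | .lp p _ _, g => fun x => (show Lp Y p (volume : Measure (Rn n)) from g) x

/-- The weighted space `wX = {w g : g ∈ X}` with norm `‖f‖ = ‖f / w‖_X`, `w = (1 + ‖·‖)ᵏ`.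
As `w > 0`, an element `f` is the same as `g = f / w ∈ X`, and it is stored as this `g`;
the function `f = w g` itself is `WeightedSpace.toFun f`. -/
def WeightedSpace (κ : SpaceKind) (_k : ℝ) : Type _ := BaseSpace n Y κ

instance (κ : SpaceKind) (k : ℝ) : NormedAddCommGroup (WeightedSpace n Y κ k) :=
  inferInstanceAs (NormedAddCommGroup (BaseSpace n Y κ))

instance (κ : SpaceKind) (k : ℝ) : NormedSpace ℂ (WeightedSpace n Y κ k) :=
  inferInstanceAs (NormedSpace ℂ (BaseSpace n Y κ))

theorem isClosed_BUC : IsClosed (BUC n Y : Set (Rn n →ᵇ Y)) := by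
  rw [← isSeqClosed_iff_isClosed]
  intro u g hu hg
  exact (BoundedContinuousFunction.tendsto_iff_tendstoUniformly.1 hg).uniformContinuous
    (Eventually.of_forall hu).frequently

/-- `wX` is complete, so that Bochner integrals in `wX` make sense. -/
instance [CompleteSpace Y] (κ : SpaceKind) (k : ℝ) : CompleteSpace (WeightedSpace n Y κ k) :=
  match κ with
  | .buc => (isClosed_BUC n Y).completeSpace_coe
  | .c0 => inferInstanceAs (CompleteSpace C₀(Rn n, Y))
  | .lp p h _ =>
    haveI : Fact (1 ≤ p) := ⟨h⟩
    inferInstanceAs (CompleteSpace (Lp Y p (volume : Measure (Rn n))))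

end Spaces

section Heat

variable {n : ℕ} {Y : Type*} [NormedAddCommGroup Y] [NormedSpace ℂ Y]

/-- The function `f = w g : ℝⁿ → Y` (for `Lᵖ`: a representative of the class `f`). -/
def WeightedSpace.toFun {κ : SpaceKind} {k : ℝ} (f : WeightedSpace n Y κ k) (x : Rn n) : Y :=
  weight k x • BaseSpace.toFun (show BaseSpace n Y κ from f) x

/-- The partial derivative `∂v/∂xⱼ`. -/
def partialDeriv {F : Type*} [NormedAddCommGroup F] [NormedSpace ℝ F]
    (j : Fin n) (v : Rn n → F) (x : Rn n) : F :=
  lineDeriv ℝ v x (EuclideanSpace.single j 1)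

/-- The Laplacian `∑ⱼ ∂²v/∂xⱼ²`. -/
def laplace {F : Type*} [NormedAddCommGroup F] [NormedSpace ℝ F]
    (v : Rn n → F) (x : Rn n) : F :=
  ∑ j : Fin n, partialDeriv j (partialDeriv j v) x

/-- `f ∈ D(Δ_{wX})` and `Δ_{wX} f = g`: the element `g` of `wX` is the distributional Laplacian
of `f ∈ wX`. -/
def HasLaplacian {κ : SpaceKind} {k : ℝ} (f g : WeightedSpace n Y κ k) : Prop :=
  ∀ φ : Rn n → ℝ, ContDiff ℝ ∞ φ → HasCompactSupport φ →
    ∫ x, laplace φ x • f.toFun x = ∫ x, φ x • g.toFun x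

/-- Mild solutions `u : [0, ∞) → wX` of `u' = Δ_{wX} u`: `u` is continuous and, for all `t ≥ 0`,
`∫₀ᵗ u(s) ds ∈ D(Δ_{wX})` with `u(t) = u(0) + Δ_{wX} ∫₀ᵗ u(s) ds`. Values at `t < 0` are
irrelevant. -/
def IsMildSolution {κ : SpaceKind} {k : ℝ} (u : ℝ → WeightedSpace n Y κ k) : Prop :=
  ContinuousOn u (Ici 0) ∧ ∀ t, 0 ≤ t → HasLaplacian (∫ s in (0 : ℝ)..t, u s) (u t - u 0)

/-- `u` is continuously differentiable from `(0, ∞)` to `wX`, takes its values in `D(Δ_{wX})`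
there, and `u'(t) = Δ_{wX} u(t)` for all `t > 0`. -/
def IsC1Solution {κ : SpaceKind} {k : ℝ} (u : ℝ → WeightedSpace n Y κ k) : Prop :=
  ContDiffOn ℝ 1 u (Ioi 0) ∧ ∀ t, 0 < t → HasLaplacian (u t) (deriv u t)

/-- The integrand of the Gauss–Poisson integral. -/
def gaussIntegrand (t : ℝ) (f : Rn n → Y) (x y : Rn n) : Y :=
  Real.exp (-‖y‖ ^ 2 / (4 * t)) • f (x - y)

/-- The Gauss–Poisson formula
`(G(t)f)(x) = (4πt)^(-n/2) ∫ f(x - y) exp(-‖y‖² / 4t) dy`, for `t > 0`. -/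
def gaussPoisson (t : ℝ) (f : Rn n → Y) (x : Rn n) : Y :=
  (4 * Real.pi * t) ^ (-(n : ℝ) / 2) • ∫ y, gaussIntegrand t f x y

/-- The set `M = (0, ∞) × ℝⁿ`. -/
def openHalfSpace (n : ℕ) : Set (ℝ × Rn n) := Ioi 0 ×ˢ univ

/-- `v` is a classical solution of `∂v/∂t = ∑ⱼ ∂²v/∂xⱼ²` on `M`: the function `v` and the
derivatives `∂v/∂t`, `∂v/∂xⱼ`, `∂²v/∂xⱼ²` exist and are continuous on `M`, and the equation
holds at every point of `M`. -/
structure IsClassicalSolution (v : ℝ → Rn n → Y) : Prop where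
  continuousOn : ContinuousOn (fun z : ℝ × Rn n => v z.1 z.2) (openHalfSpace n)
  differentiableAt_time : ∀ t, 0 < t → ∀ x, DifferentiableAt ℝ (fun s => v s x) t
  continuousOn_time : ContinuousOn (fun z : ℝ × Rn n => deriv (fun s => v s z.2) z.1)
    (openHalfSpace n)
  differentiableAt_space : ∀ t, 0 < t → ∀ x, ∀ j : Fin n,
    LineDifferentiableAt ℝ (v t) x (EuclideanSpace.single j 1)
  continuousOn_space : ∀ j : Fin n,
    ContinuousOn (fun z : ℝ × Rn n => partialDeriv j (v z.1) z.2) (openHalfSpace n)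
  differentiableAt_space₂ : ∀ t, 0 < t → ∀ x, ∀ j : Fin n,
    LineDifferentiableAt ℝ (partialDeriv j (v t)) x (EuclideanSpace.single j 1)
  continuousOn_space₂ : ∀ j : Fin n,
    ContinuousOn (fun z : ℝ × Rn n => partialDeriv j (partialDeriv j (v z.1)) z.2)
      (openHalfSpace n)
  equation : ∀ t, 0 < t → ∀ x, deriv (fun s => v s x) t = laplace (v t) x

/-- `u(t) = G(t)f` for all `t ≥ 0`, where `G(0)f = f`; for `t > 0` the Gauss–Poisson integral
exists at every point. Equality in `wX` with the continuous function `G(t)f` is equality almost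
everywhere (for the spaces of continuous functions this is equality everywhere). -/
def IsGaussOrbit {κ : SpaceKind} {k : ℝ} (u : ℝ → WeightedSpace n Y κ k)
    (f : WeightedSpace n Y κ k) : Prop :=
  u 0 = f ∧ ∀ t, 0 < t → (∀ x, Integrable (gaussIntegrand t f.toFun x)) ∧
    (u t).toFun =ᵐ[volume] gaussPoisson t f.toFun

end Heat

end WeightedHeat

end

/-!
Translations `T_y f = f(· - y)` act on `wX`: on `g = f / w` they become
`g ↦ g(· - y) w(· - y) / w`, and since `w` is submultiplicative and `w(x - y) / w(x)` is uniformly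
continuous in `(x, y)` for bounded `y`, they form a strongly continuous family with
`‖T_y‖ ≤ w(y)` (`WeightedSpace.exists_translation`). Moreover `wX` embeds continuously into the
space `L¹((1 + ‖x‖)^(-N) dx)`, `N = k + n + 1` (`WeightedSpace.exists_integral_bound`), so test
functions act continuously on it and separate points. Together with elementary facts about
representatives, this is all that is used about the three kinds of space `X`.

The Gauss–Poisson integral is then the Bochner integral `G(t) f = ∫ K_t(y) T_y f dy` in `wX`, or,
after scaling, `∫ K₁(z) T_{√t z} f dz`. The second form makes continuity down to `t = 0` plain
(`continuous_heatOp`). Smoothness, both of `t ↦ G(t) f` with values in `wX` and of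
`(t, x) ↦ (G(t) f)(x)`, comes from one statement: completing the square turns both integrals into
`∫ exp(⟪y, ξ⟫ - s ‖y‖²) F(y) dy`, whose derivative in `(s, ξ)` is an integral of the same form with
another `F` (`contDiffAt_gaussLaplace`). As `∂_t K_t = Δ K_t`, testing against smooth compactly
supported functions gives `(G(t) f)' = Δ G(t) f`, and hence the mild equation, and hence also the
pointwise heat equation for the smooth function `(t, x) ↦ (G(t) f)(x)`
(`isClassicalSolution_of_contDiffOn`).

Mild solutions are unique because `G(t)` commutes with `Δ` on its domain
(`HasLaplacian.integral_heatKernelDeriv`): if `u` is a mild solution with `u(0) = 0` and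
`U(s) = ∫₀ˢ u`, then `s ↦ G(t - s) U(s)` has derivative zero, so `U(t) = G(t) U(0) = 0`
(`eq_zero_of_hasLaplacian_integral`).

For a classical solution `v` that is locally bounded in `wX`, continuity in time with values in `wX`
is not known beforehand. It does hold with values in the weighted `L¹` space with exponent
`N + 1`, where the additional decay controls the tails (`continuousOn_weightedL1`). There, started
at any time `a > 0`, `v` is a mild solution, and uniqueness gives `v(a + s) = G(s) v(a)`. This
identity between functions holds in `wX` as well, and the claim follows by letting `a → 0`.
-/

noncomputable section

namespace WeightedHeat

/-! ### Weights -/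

section Weight

variable {n : ℕ}

theorem one_add_norm_pos (x : Rn n) : 0 < 1 + ‖x‖ := by positivity

theorem weight_pos (k : ℝ) (x : Rn n) : 0 < weight k x :=
  Real.rpow_pos_of_pos (one_add_norm_pos x) k

theorem continuous_weight (k : ℝ) : Continuous (weight k : Rn n → ℝ) :=
  (continuous_const.add continuous_norm).rpow_const fun x => Or.inl (one_add_norm_pos x).ne'

theorem weight_mul_weight (a b : ℝ) (x : Rn n) : weight a x * weight b x = weight (a + b) x :=
  (Real.rpow_add (one_add_norm_pos x) a b).symm

theorem weight_neg (k : ℝ) (x : Rn n) : weight k (-x) = weight k x := by simp [weight]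

/-- Weights are submultiplicative; this is what bounds translations on `wX`. -/
theorem weight_add_le {k : ℝ} (hk : 0 ≤ k) (x y : Rn n) :
    weight k (x + y) ≤ weight k x * weight k y := by
  unfold weight
  rw [← Real.mul_rpow (one_add_norm_pos x).le (one_add_norm_pos y).le]
  refine Real.rpow_le_rpow (one_add_norm_pos _).le ?_ hk
  nlinarith [norm_add_le x y, mul_nonneg (norm_nonneg x) (norm_nonneg y)]

theorem integrable_weight_neg {r : ℝ} (hr : (n : ℝ) < r) :
    Integrable (weight (-r) : Rn n → ℝ) :=
  integrable_one_add_norm (by simpa using hr)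

/-- The factor `w(x - y) / w(x)` by which translation by `y` acts on `g = f / w`. -/
def weightRatio (k : ℝ) (y x : Rn n) : ℝ := weight k (x - y) / weight k x

theorem weightRatio_nonneg (k : ℝ) (y x : Rn n) : 0 ≤ weightRatio k y x :=
  (div_pos (weight_pos k _) (weight_pos k _)).le

theorem weightRatio_le {k : ℝ} (hk : 0 ≤ k) (y x : Rn n) : weightRatio k y x ≤ weight k y := by
  rw [weightRatio, div_le_iff₀ (weight_pos k x), mul_comm, sub_eq_add_neg, ← weight_neg k y]
  exact weight_add_le hk x (-y)

theorem continuous_weightRatio (k : ℝ) (y : Rn n) : Continuous (weightRatio k y) :=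
  ((continuous_weight k).comp (continuous_id.sub continuous_const)).div (continuous_weight k)
    fun x => (weight_pos k x).ne'

theorem norm_weightRatio_smul_le {F : Type*} [NormedAddCommGroup F] [NormedSpace ℝ F] {k : ℝ}
    (hk : 0 ≤ k) (y x : Rn n) (v : F) : ‖weightRatio k y x • v‖ ≤ weight k y * ‖v‖ := by
  rw [norm_smul, Real.norm_of_nonneg (weightRatio_nonneg k y x)]
  exact mul_le_mul_of_nonneg_right (weightRatio_le hk y x) (norm_nonneg v)

theorem weight_smul_weightRatio_smul {F : Type*} [AddCommGroup F] [Module ℝ F] (k : ℝ)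
    (y x : Rn n) (v : F) : weight k x • weightRatio k y x • v = weight k (x - y) • v := by
  rw [smul_smul, weightRatio, mul_div_cancel₀ _ (weight_pos k x).ne']

theorem abs_log_one_add_norm_sub_le (x y : Rn n) :
    |Real.log (1 + ‖x‖) - Real.log (1 + ‖y‖)| ≤ ‖x - y‖ := by
  have key : ∀ x y : Rn n, Real.log (1 + ‖x‖) - Real.log (1 + ‖y‖) ≤ ‖x - y‖ := by
    intro x y
    have hx := one_add_norm_pos x
    have hy := one_add_norm_pos y
    rw [← Real.log_div hx.ne' hy.ne']
    refine (Real.log_le_sub_one_of_pos (div_pos hx hy)).trans ?_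
    rw [sub_le_iff_le_add, div_le_iff₀ hy]
    nlinarith [norm_le_norm_add_norm_sub' x y, norm_nonneg (x - y), norm_nonneg y,
      mul_nonneg (norm_nonneg (x - y)) (norm_nonneg y)]
  rw [abs_sub_le_iff]
  exact ⟨key x y, (key y x).trans_eq (norm_sub_rev y x)⟩

/-- The logarithm of `w(x - y) / w(x)` is Lipschitz and bounded for bounded `y`, so the quotient
is uniformly continuous in `(x, y)` there. -/
theorem uniformContinuousOn_weightRatio (k R : ℝ) :
    UniformContinuousOn (fun z : Rn n × Rn n => weightRatio k z.2 z.1)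
      {z | ‖z.2‖ ≤ R} := by
  set l : Rn n → ℝ := fun x => Real.log (1 + ‖x‖) with hl
  have hlu : UniformContinuous l := by
    refine (LipschitzWith.of_dist_le_mul (K := 1) fun x y => ?_).uniformContinuous
    rw [Real.dist_eq, dist_eq_norm]
    simpa using abs_log_one_add_norm_sub_le x y
  have hd : UniformContinuous fun z : Rn n × Rn n => k * (l (z.1 - z.2) - l z.1) :=
    Real.uniformContinuous_const_mul.comp
      ((hlu.comp (uniformContinuous_fst.sub uniformContinuous_snd)).sub
        (hlu.comp uniformContinuous_fst))
  have he : UniformContinuousOn Real.exp (Icc (-(|k| * R)) (|k| * R)) :=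
    isCompact_Icc.uniformContinuousOn_of_continuous Real.continuous_exp.continuousOn
  have hm : MapsTo (fun z : Rn n × Rn n => k * (l (z.1 - z.2) - l z.1)) {z | ‖z.2‖ ≤ R}
      (Icc (-(|k| * R)) (|k| * R)) := by
    intro z hz
    rw [mem_Icc, ← abs_le, abs_mul]
    refine mul_le_mul_of_nonneg_left ?_ (abs_nonneg k)
    refine (abs_log_one_add_norm_sub_le _ _).trans ?_
    simpa using hz
  refine (he.comp hd.uniformContinuousOn hm).congr fun z _ => ?_
  simp only [Function.comp_apply, hl, weightRatio, weight]
  rw [Real.rpow_def_of_pos (one_add_norm_pos _), Real.rpow_def_of_pos (one_add_norm_pos _),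
    ← Real.exp_sub]
  congr 1
  ring

theorem uniformContinuousOn_weightRatio_smul {F : Type*} [NormedAddCommGroup F] [NormedSpace ℝ F]
    {k : ℝ} (hk : 0 ≤ k) (R : ℝ) {g : Rn n → F} (hg : UniformContinuous g) {B : ℝ}
    (hB : ∀ x, ‖g x‖ ≤ B) :
    UniformContinuousOn (fun z : Rn n × Rn n => weightRatio k z.2 z.1 • g (z.1 - z.2))
      {z | ‖z.2‖ ≤ R} := by
  have hB0 : 0 ≤ B := (norm_nonneg _).trans (hB 0)
  set W : ℝ := (1 + |R|) ^ k with hW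
  have hW0 : 0 < W := by positivity
  have hWle : ∀ z : Rn n × Rn n, ‖z.2‖ ≤ R → |weightRatio k z.2 z.1| ≤ W := by
    intro z hz
    rw [abs_of_nonneg (weightRatio_nonneg _ _ _)]
    refine (weightRatio_le hk _ _).trans (Real.rpow_le_rpow (one_add_norm_pos _).le ?_ hk)
    linarith [le_abs_self R]
  have h1 := Metric.uniformContinuousOn_iff.1 (uniformContinuousOn_weightRatio (n := n) k R)
  have h2 := Metric.uniformContinuous_iff.1
    (hg.comp (uniformContinuous_fst.sub uniformContinuous_snd) :
      UniformContinuous fun z : Rn n × Rn n => g (z.1 - z.2))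
  rw [Metric.uniformContinuousOn_iff]
  intro ε hε
  obtain ⟨d1, hd1, h1⟩ := h1 (ε / (2 * (B + 1))) (by positivity)
  obtain ⟨d2, hd2, h2⟩ := h2 (ε / (2 * W)) (by positivity)
  refine ⟨min d1 d2, lt_min hd1 hd2, fun a ha b hb hab => ?_⟩
  have e1 := h1 a ha b hb (hab.trans_le (min_le_left _ _))
  have e2 := h2 (hab.trans_le (min_le_right _ _))
  rw [Real.dist_eq] at e1
  rw [dist_eq_norm] at e2 ⊢
  set p := weightRatio k a.2 a.1
  set q := weightRatio k b.2 b.1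
  set u := g (a.1 - a.2) with hu
  set v := g (b.1 - b.2)
  have : p • u - q • v = (p - q) • u + q • (u - v) := by
    rw [sub_smul, smul_sub]; abel
  rw [this]
  refine (norm_add_le _ _).trans_lt ?_
  rw [norm_smul, norm_smul, Real.norm_eq_abs, Real.norm_eq_abs]
  have hb1 : |p - q| * ‖u‖ ≤ ε / (2 * (B + 1)) * B :=
    mul_le_mul e1.le (hB _) (norm_nonneg _) (by positivity)
  have hb2 : |q| * ‖u - v‖ ≤ W * ‖u - v‖ :=
    mul_le_mul_of_nonneg_right (hWle b hb) (norm_nonneg _)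
  have hb3 : W * ‖u - v‖ < ε / 2 := by
    have := mul_lt_mul_of_pos_left e2 hW0
    calc W * ‖u - v‖ < W * (ε / (2 * W)) := this
      _ = ε / 2 := by field_simp
  have hb4 : ε / (2 * (B + 1)) * B ≤ ε / 2 := by
    rw [div_mul_eq_mul_div, div_le_div_iff₀ (by positivity) (by positivity)]
    nlinarith
  linarith

/-- Uniform form of the continuity of `y ↦ g(· - y) w(· - y) / w`. -/
theorem eventually_forall_weightRatio_smul_sub_le {F : Type*} [NormedAddCommGroup F]
    [NormedSpace ℝ F] {k : ℝ} (hk : 0 ≤ k) {g : Rn n → F} (hg : UniformContinuous g) {B : ℝ}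
    (hB : ∀ x, ‖g x‖ ≤ B) (y₀ : Rn n) {ε : ℝ} (hε : 0 < ε) :
    ∀ᶠ y in 𝓝 y₀, ∀ x,
      ‖weightRatio k y x • g (x - y) - weightRatio k y₀ x • g (x - y₀)‖ ≤ ε := by
  obtain ⟨d, hd, h⟩ := Metric.uniformContinuousOn_iff.1
    (uniformContinuousOn_weightRatio_smul hk (‖y₀‖ + 1) hg hB) ε hε
  filter_upwards [Metric.ball_mem_nhds y₀ (lt_min hd one_pos)] with y hy x
  have hy' := Metric.mem_ball.1 hy
  have := h (x, y) ?_ (x, y₀) ?_ ?_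
  · rw [dist_eq_norm] at this
    exact this.le
  · have h1 := norm_le_norm_add_norm_sub' y y₀
    rw [← dist_eq_norm] at h1
    have := hy'.trans_le (min_le_right _ _)
    simp only [mem_ofPred_eq]
    linarith
  · simp
  · rw [Prod.dist_eq]
    simpa [hd] using hy'.trans_le (min_le_left _ _)

theorem uniformContinuous_weightRatio_smul {F : Type*} [NormedAddCommGroup F] [NormedSpace ℝ F]
    {k : ℝ} (hk : 0 ≤ k) (y : Rn n) {g : Rn n → F} (hg : UniformContinuous g) {B : ℝ}
    (hB : ∀ x, ‖g x‖ ≤ B) :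
    UniformContinuous fun x => weightRatio k y x • g (x - y) := by
  rw [← uniformContinuousOn_univ]
  exact (uniformContinuousOn_weightRatio_smul hk ‖y‖ hg hB).comp
    (f := fun x : Rn n => (x, y))
    (uniformContinuous_id.prodMk uniformContinuous_const).uniformContinuousOn
    fun x _ => le_refl ‖y‖

end Weight

/-! ### The underlying function of an element of `wX` -/

section Spaces

variable {n : ℕ} {Y : Type*} [NormedAddCommGroup Y] [NormedSpace ℂ Y] {κ : SpaceKind} {k : ℝ}

theorem BaseSpace.toFun_add (f g : BaseSpace n Y κ) :
    (f + g).toFun =ᵐ[volume] fun x => f.toFun x + g.toFun x := by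
  match κ with
  | .buc => exact Eventually.of_forall fun x => rfl
  | .c0 => exact Eventually.of_forall fun x => rfl
  | .lp p h _ =>
    have : Fact (1 ≤ p) := ⟨h⟩
    exact Lp.coeFn_add (show Lp Y p (volume : Measure (Rn n)) from f) g

theorem BaseSpace.toFun_smul (c : ℂ) (f : BaseSpace n Y κ) :
    (c • f).toFun =ᵐ[volume] fun x => c • f.toFun x := by
  match κ with
  | .buc => exact Eventually.of_forall fun x => rfl
  | .c0 => exact Eventually.of_forall fun x => rfl
  | .lp p h _ =>
    have : Fact (1 ≤ p) := ⟨h⟩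
    exact Lp.coeFn_smul c (show Lp Y p (volume : Measure (Rn n)) from f)

theorem BaseSpace.ext_ae {f g : BaseSpace n Y κ} (h : f.toFun =ᵐ[volume] g.toFun) : f = g := by
  match κ with
  | .buc =>
    refine Subtype.ext (DFunLike.coe_injective ?_)
    exact ((show BUC n Y from f).1.continuous.ae_eq_iff_eq volume
      (show BUC n Y from g).1.continuous).1 h
  | .c0 =>
    let f' : C₀(Rn n, Y) := f
    let g' : C₀(Rn n, Y) := g
    have : (f' : Rn n → Y) = g' :=
      (f'.continuous_toFun.ae_eq_iff_eq volume g'.continuous_toFun).1 h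
    exact show f' = g' from DFunLike.coe_injective this
  | .lp p h1 _ => exact Lp.ext h

theorem BaseSpace.aestronglyMeasurable_toFun (f : BaseSpace n Y κ) :
    AEStronglyMeasurable f.toFun volume := by
  match κ with
  | .buc => exact (show BUC n Y from f).1.continuous.aestronglyMeasurable
  | .c0 => exact (show C₀(Rn n, Y) from f).continuous.aestronglyMeasurable
  | .lp p h _ => exact Lp.aestronglyMeasurable (show Lp Y p (volume : Measure (Rn n)) from f)

theorem WeightedSpace.toFun_add (f g : WeightedSpace n Y κ k) :
    (f + g).toFun =ᵐ[volume] fun x => f.toFun x + g.toFun x := by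
  filter_upwards [BaseSpace.toFun_add (show BaseSpace n Y κ from f) g] with x hx
  simp only [WeightedSpace.toFun, ← smul_add]
  exact congrArg _ hx

theorem WeightedSpace.toFun_smul (c : ℝ) (f : WeightedSpace n Y κ k) :
    (c • f).toFun =ᵐ[volume] fun x => c • f.toFun x := by
  filter_upwards [BaseSpace.toFun_smul (c : ℂ) (show BaseSpace n Y κ from f)] with x hx
  simp only [WeightedSpace.toFun]
  rw [smul_comm]
  exact congrArg _ hx

theorem WeightedSpace.ext_ae {f g : WeightedSpace n Y κ k} (h : f.toFun =ᵐ[volume] g.toFun) :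
    f = g := by
  refine BaseSpace.ext_ae (κ := κ) ?_
  filter_upwards [h] with x hx
  exact smul_right_injective Y (weight_pos k x).ne' hx

theorem WeightedSpace.aestronglyMeasurable_toFun (f : WeightedSpace n Y κ k) :
    AEStronglyMeasurable f.toFun volume :=
  (continuous_weight k).aestronglyMeasurable.smul (BaseSpace.aestronglyMeasurable_toFun _)

/-! ### Embedding into a weighted `L¹` space -/

/-- The embedding of `X` into `L¹(ℝⁿ, (1 + ‖x‖)^(-(n + 1)) dx; Y)`. -/
theorem BaseSpace.exists_integral_bound (n : ℕ) (Y : Type*) [NormedAddCommGroup Y]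
    [NormedSpace ℂ Y] (κ : SpaceKind) : ∃ C : ℝ, ∀ f : BaseSpace n Y κ,
    Integrable (fun x => weight (-(n + 1)) x • f.toFun x) ∧
      ∫ x, ‖weight (-(n + 1)) x • f.toFun x‖ ≤ C * ‖f‖ := by
  have hm : Integrable (weight (-((n : ℝ) + 1)) : Rn n → ℝ) := integrable_weight_neg (by simp)
  -- both spaces of continuous functions consist of measurable functions bounded by the norm
  have hsup : ∀ (g : Rn n → Y) (B : ℝ), AEStronglyMeasurable g volume → (∀ x, ‖g x‖ ≤ B) →
      Integrable (fun x => weight (-((n : ℝ) + 1)) x • g x) ∧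
      ∫ x, ‖weight (-((n : ℝ) + 1)) x • g x‖ ≤
        (∫ x : Rn n, weight (-((n : ℝ) + 1)) x) * B := by
    intro g B hg hB
    have hle : ∀ x, ‖weight (-((n : ℝ) + 1)) x • g x‖ ≤ weight (-((n : ℝ) + 1)) x * B := by
      intro x
      rw [norm_smul, Real.norm_of_nonneg (weight_pos _ x).le]
      exact mul_le_mul_of_nonneg_left (hB x) (weight_pos _ x).le
    have hi : Integrable (fun x => weight (-((n : ℝ) + 1)) x • g x) :=
      (hm.mul_const B).mono' ((continuous_weight _).aestronglyMeasurable.smul hg)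
        (Eventually.of_forall hle)
    refine ⟨hi, ?_⟩
    rw [← integral_mul_const]
    exact integral_mono hi.norm (hm.mul_const B) hle
  match κ with
  | .buc =>
    exact ⟨_, fun f => hsup _ _ (BaseSpace.aestronglyMeasurable_toFun f)
      fun x => (show BUC n Y from f).1.norm_coe_le_norm x⟩
  | .c0 =>
    refine ⟨_, fun f => hsup _ _ (BaseSpace.aestronglyMeasurable_toFun f) fun x => ?_⟩
    exact (show C₀(Rn n, Y) from f).toBCF.norm_coe_le_norm x
  | .lp p h hp =>
    have : Fact (1 ≤ p) := ⟨h⟩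
    -- `ν` is finite and at most Lebesgue measure, so `L¹(ν)` norms are bounded by `Lᵖ` norms
    set ν : Measure (Rn n) :=
      volume.withDensity fun x => ENNReal.ofReal (weight (-((n : ℝ) + 1)) x) with hν
    have hmeas : Measurable fun x : Rn n => ENNReal.ofReal (weight (-((n : ℝ) + 1)) x) :=
      (continuous_weight _).measurable.ennreal_ofReal
    have hνle : ν ≤ volume := by
      conv_rhs => rw [← withDensity_one (μ := (volume : Measure (Rn n)))]
      refine withDensity_mono (Eventually.of_forall fun x => ?_)
      simp only [Pi.one_apply, ENNReal.ofReal_le_one]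
      exact Real.rpow_le_one_of_one_le_of_nonpos (by linarith [norm_nonneg x])
        (by linarith [n.cast_nonneg (α := ℝ)])
    have hfin : ν univ < ⊤ := by
      rw [hν, withDensity_apply _ MeasurableSet.univ, setLIntegral_univ]
      exact hm.lintegral_lt_top
    set c : ℝ≥0∞ := ν univ ^ (1 / (1 : ℝ≥0∞).toReal - 1 / p.toReal) with hc
    have hpr : 1 ≤ p.toReal := by
      rw [← ENNReal.toReal_one]
      exact ENNReal.toReal_mono hp h
    have hcfin : c < ⊤ := by
      refine ENNReal.rpow_lt_top_of_nonneg ?_ hfin.ne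
      simp only [ENNReal.toReal_one, div_one, sub_nonneg]
      rw [div_le_one (by linarith)]
      exact hpr
    refine ⟨c.toReal, fun f => ?_⟩
    set g : Lp Y p (volume : Measure (Rn n)) := f with hg
    have hgm := Lp.aestronglyMeasurable g
    have hle : eLpNorm g 1 ν ≤ eLpNorm g p volume * c :=
      (eLpNorm_le_eLpNorm_mul_rpow_measure_univ h (hgm.mono_measure hνle)).trans
        (mul_le_mul' (eLpNorm_mono_measure _ hνle) le_rfl)
    have hlint : ∫⁻ x, ‖weight (-((n : ℝ) + 1)) x • g x‖ₑ = eLpNorm g 1 ν := by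
      rw [eLpNorm_one_eq_lintegral_enorm, hν,
        lintegral_withDensity_eq_lintegral_mul_non_measurable₀]
      · refine lintegral_congr fun x => ?_
        rw [enorm_smul, Pi.mul_apply, Real.enorm_of_nonneg (weight_pos _ x).le]
      · exact hmeas.aemeasurable
      · exact Eventually.of_forall fun x => ENNReal.ofReal_lt_top
    have hlt : eLpNorm g p volume * c < ⊤ := ENNReal.mul_lt_top (Lp.eLpNorm_lt_top g) hcfin
    have hm' : AEStronglyMeasurable (fun x => weight (-((n : ℝ) + 1)) x • g x) volume :=
      (continuous_weight _).aestronglyMeasurable.smul hgm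
    refine ⟨⟨hm', ?_⟩, ?_⟩
    · rw [hasFiniteIntegral_iff_enorm]
      exact (hlint.trans_le hle).trans_lt hlt
    · change ∫ x, ‖weight (-((n : ℝ) + 1)) x • g x‖ ≤ c.toReal * ‖g‖
      rw [integral_norm_eq_lintegral_enorm hm', hlint, Lp.norm_def, mul_comm, ← ENNReal.toReal_mul]
      exact ENNReal.toReal_mono hlt.ne hle

/-- The embedding of `wX` into `L¹(ℝⁿ, (1 + ‖x‖)^(-(k + n + 1)) dx; Y)`. -/
theorem WeightedSpace.exists_integral_bound (n : ℕ) (Y : Type*) [NormedAddCommGroup Y]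
    [NormedSpace ℂ Y] (κ : SpaceKind) (k : ℝ) : ∃ C : ℝ, ∀ f : WeightedSpace n Y κ k,
    Integrable (fun x => weight (-(k + n + 1)) x • f.toFun x) ∧
      ∫ x, ‖weight (-(k + n + 1)) x • f.toFun x‖ ≤ C * ‖f‖ := by
  obtain ⟨C, hC⟩ := BaseSpace.exists_integral_bound n Y κ
  refine ⟨C, fun f => ?_⟩
  have : (fun x => weight (-(k + n + 1)) x • f.toFun x) =
      fun x => weight (-((n : ℝ) + 1)) x • BaseSpace.toFun (show BaseSpace n Y κ from f) x := by
    funext x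
    rw [WeightedSpace.toFun, smul_smul, weight_mul_weight]
    congr 2
    ring
  have h2 := hC f
  rw [this]
  refine ⟨h2.1, ?_⟩
  simp_rw [funext_iff] at this
  simp_rw [this]
  exact h2.2

/-! ### Translations -/

/-- Translation of `f = w g` by `y`, expressed through `g`: a family of elements of `X` that is
bounded by the weight and continuous in `y`. -/
theorem BaseSpace.exists_translate (hk : 0 ≤ k) (f : BaseSpace n Y κ) :
    ∃ τ : Rn n → BaseSpace n Y κ,
      (∀ y, (τ y).toFun =ᵐ[volume] fun x => weightRatio k y x • f.toFun (x - y)) ∧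
      (∀ y, ‖τ y‖ ≤ weight k y * ‖f‖) ∧ Continuous τ := by
  match κ with
  | .buc =>
    set g : BUC n Y := f with hg
    have hb : ∀ x, ‖g.1 x‖ ≤ ‖g‖ := fun x => g.1.norm_coe_le_norm x
    have hB : ∀ y x, ‖weightRatio k y x • g.1 (x - y)‖ ≤ weight k y * ‖g‖ := fun y x =>
      (norm_weightRatio_smul_le hk y x _).trans
        (mul_le_mul_of_nonneg_left (hb _) (weight_pos k y).le)
    let τ : Rn n → BUC n Y := fun y =>
      ⟨BoundedContinuousFunction.ofNormedAddCommGroup (fun x => weightRatio k y x • g.1 (x - y))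
        (uniformContinuous_weightRatio_smul hk y g.2 hb).continuous _ (hB y),
        uniformContinuous_weightRatio_smul hk y g.2 hb⟩
    refine ⟨τ, fun y => Eventually.of_forall fun x => rfl, fun y => ?_, ?_⟩
    · exact (BoundedContinuousFunction.norm_le
        (mul_nonneg (weight_pos k y).le (norm_nonneg g))).2 (hB y)
    · refine continuous_iff_continuousAt.2 fun y₀ => ?_
      change Tendsto τ (𝓝 y₀) (𝓝 (τ y₀))
      refine Metric.tendsto_nhds.2 fun ε hε => ?_
      filter_upwards [eventually_forall_weightRatio_smul_sub_le hk g.2 hb y₀ (half_pos hε)]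
        with y hy
      refine lt_of_le_of_lt ?_ (half_lt_self hε)
      rw [dist_eq_norm]
      exact (BoundedContinuousFunction.norm_le (half_pos hε).le).2 hy
  | .c0 =>
    set g : C₀(Rn n, Y) := f with hg
    have hb : ∀ x, ‖g x‖ ≤ ‖g‖ := fun x => g.toBCF.norm_coe_le_norm x
    have hB : ∀ y x, ‖weightRatio k y x • g (x - y)‖ ≤ weight k y * ‖g (x - y)‖ := fun y x =>
      norm_weightRatio_smul_le hk y x _
    have hu := ZeroAtInftyContinuousMap.uniformContinuous g
    let τ : Rn n → C₀(Rn n, Y) := fun y =>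
      { toFun := fun x => weightRatio k y x • g (x - y)
        continuous_toFun := (uniformContinuous_weightRatio_smul hk y hu hb).continuous
        zero_at_infty' := by
          refine squeeze_zero_norm (hB y) ?_
          have h1 : Tendsto (fun x : Rn n => x - y) (cocompact _) (cocompact _) :=
            (Homeomorph.subRight y).isClosedEmbedding.tendsto_cocompact
          simpa using ((g.zero_at_infty'.comp h1).norm).const_mul (weight k y) }
    refine ⟨τ, fun y => Eventually.of_forall fun x => rfl, fun y => ?_, ?_⟩
    · change ‖τ y‖ ≤ weight k y * ‖g‖
      rw [← ZeroAtInftyContinuousMap.norm_toBCF_eq_norm]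
      exact (BoundedContinuousFunction.norm_le
        (mul_nonneg (weight_pos k y).le (norm_nonneg g))).2 fun x =>
          (hB y x).trans (mul_le_mul_of_nonneg_left (hb _) (weight_pos k y).le)
    · refine continuous_iff_continuousAt.2 fun y₀ => ?_
      change Tendsto τ (𝓝 y₀) (𝓝 (τ y₀))
      refine Metric.tendsto_nhds.2 fun ε hε => ?_
      filter_upwards [eventually_forall_weightRatio_smul_sub_le hk hu hb y₀ (half_pos hε)]
        with y hy
      refine lt_of_le_of_lt ?_ (half_lt_self hε)
      rw [dist_eq_norm, ← ZeroAtInftyContinuousMap.norm_toBCF_eq_norm]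
      exact (BoundedContinuousFunction.norm_le (half_pos hε).le).2 hy
  | .lp p h hp =>
    have : Fact (1 ≤ p) := ⟨h⟩
    set g : Lp Y p (volume : Measure (Rn n)) := f with hg
    have hmp : ∀ y : Rn n, MeasurePreserving (fun x : Rn n => x - y) volume volume :=
      fun y => measurePreserving_sub_right volume y
    let P : Rn n → Lp Y p (volume : Measure (Rn n)) := fun y =>
      Lp.compMeasurePreserving (fun x => x - y) (hmp y) g
    have hPae : ∀ y, P y =ᵐ[volume] fun x => g (x - y) := fun y =>
      Lp.coeFn_compMeasurePreserving g (hmp y)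
    have hPnorm : ∀ y, ‖P y‖ = ‖g‖ := fun y => Lp.norm_compMeasurePreserving g (hmp y)
    have hPc : Continuous P := by
      let G : Rn n → C(Rn n, Rn n) := fun y => ⟨fun x => x - y, by fun_prop⟩
      have hG : Continuous G := ContinuousMap.continuous_of_continuous_uncurry _ (by
        change Continuous fun z : Rn n × Rn n => z.2 - z.1
        fun_prop)
      exact (continuous_const (y := g)).compMeasurePreservingLp hG hmp hp
    have hmem : ∀ (y : Rn n) (a : Lp Y p (volume : Measure (Rn n))),
        MemLp (fun x => weightRatio k y x • a x) p volume := fun y a =>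
      (Lp.memLp a).of_le_mul (c := weight k y)
        ((continuous_weightRatio k y).aestronglyMeasurable.smul (Lp.aestronglyMeasurable a))
        (Eventually.of_forall fun x => norm_weightRatio_smul_le hk y x _)
    -- `Q y` multiplies by the ratio of weights, `P y` translates
    let Q : Rn n → Lp Y p (volume : Measure (Rn n)) → Lp Y p (volume : Measure (Rn n)) :=
      fun y a => (hmem y a).toLp _
    have hQae : ∀ y a, Q y a =ᵐ[volume] fun x => weightRatio k y x • a x := fun y a =>
      MemLp.coeFn_toLp _
    have hQnorm : ∀ y a, ‖Q y a‖ ≤ weight k y * ‖a‖ := fun y a => by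
      refine Lp.norm_le_mul_norm_of_ae_le_mul ?_
      filter_upwards [hQae y a] with x hx
      rw [hx]
      exact norm_weightRatio_smul_le hk y x _
    refine ⟨fun y => Q y (P y), fun y => ?_, fun y => ?_, ?_⟩
    · filter_upwards [hQae y (P y), hPae y] with x h1 h2
      rw [h2] at h1
      exact h1
    · have := hQnorm y (P y)
      rw [hPnorm] at this
      exact this
    · refine continuous_iff_continuousAt.2 fun y₀ => ?_
      change Tendsto (fun y => Q y (P y)) (𝓝 y₀) (𝓝 (Q y₀ (P y₀)))
      have hsplit : ∀ y, Q y (P y) = Q y (P y - P y₀) + Q y (P y₀) := fun y => by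
        refine Lp.ext ?_
        filter_upwards [hQae y (P y), hQae y (P y - P y₀), hQae y (P y₀),
          Lp.coeFn_sub (P y) (P y₀), Lp.coeFn_add (Q y (P y - P y₀)) (Q y (P y₀))]
          with x h1 h2 h3 h4 h5
        rw [h5, Pi.add_apply, h1, h2, h3, h4, Pi.sub_apply, smul_sub, sub_add_cancel]
      have h1 : Tendsto (fun y => Q y (P y - P y₀)) (𝓝 y₀) (𝓝 0) := by
        refine squeeze_zero_norm (fun y => hQnorm y _) ?_
        have : Tendsto (fun y => weight k y * ‖P y - P y₀‖) (𝓝 y₀)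
            (𝓝 (weight k y₀ * ‖P y₀ - P y₀‖)) :=
          (((continuous_weight k).mul (hPc.sub continuous_const).norm).tendsto y₀)
        simpa using this
      have h2 : Tendsto (fun y => Q y (P y₀)) (𝓝 y₀) (𝓝 (Q y₀ (P y₀))) := by
        refine Metric.tendsto_nhds.2 fun ε hε => ?_
        set δ := ε / (2 * (‖P y₀‖ + 1)) with hδ
        have hδ0 : 0 < δ := by positivity
        filter_upwards [eventually_forall_weightRatio_smul_sub_le hk (g := fun _ => (1 : ℝ))
          uniformContinuous_const (B := 1) (by simp) y₀ hδ0] with y hy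
        have : ‖Q y (P y₀) - Q y₀ (P y₀)‖ ≤ δ * ‖P y₀‖ := by
          refine Lp.norm_le_mul_norm_of_ae_le_mul ?_
          filter_upwards [hQae y (P y₀), hQae y₀ (P y₀),
            Lp.coeFn_sub (Q y (P y₀)) (Q y₀ (P y₀))] with x e1 e2 e3
          rw [e3, Pi.sub_apply, e1, e2, ← sub_smul, norm_smul]
          refine mul_le_mul_of_nonneg_right ?_ (norm_nonneg _)
          simpa using hy x
        rw [dist_eq_norm]
        refine this.trans_lt ?_
        rw [hδ, div_mul_eq_mul_div, div_lt_iff₀ (by positivity)]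
        nlinarith [norm_nonneg (P y₀)]
      have h3 := h1.add h2
      rw [zero_add] at h3
      exact h3.congr fun y => (hsplit y).symm

/-- Translations act on `wX` as a strongly continuous family of operators bounded by the
weight. -/
theorem WeightedSpace.exists_translation (n : ℕ) (Y : Type*) [NormedAddCommGroup Y]
    [NormedSpace ℂ Y] (κ : SpaceKind) {k : ℝ} (hk : 0 ≤ k) :
    ∃ T : Rn n → WeightedSpace n Y κ k →L[ℝ] WeightedSpace n Y κ k,
      (∀ y f, (T y f).toFun =ᵐ[volume] fun x => f.toFun (x - y)) ∧
      (∀ y f, ‖T y f‖ ≤ weight k y * ‖f‖) ∧ ∀ f, Continuous fun y => T y f := by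
  have key : ∀ f : WeightedSpace n Y κ k, ∃ τ : Rn n → WeightedSpace n Y κ k,
      (∀ y, (τ y).toFun =ᵐ[volume] fun x => f.toFun (x - y)) ∧
      (∀ y, ‖τ y‖ ≤ weight k y * ‖f‖) ∧ Continuous τ := by
    intro f
    obtain ⟨τ, h1, h2, h3⟩ := BaseSpace.exists_translate hk (show BaseSpace n Y κ from f)
    refine ⟨τ, fun y => ?_, h2, h3⟩
    filter_upwards [h1 y] with x hx
    exact (congrArg (weight k x • ·) hx).trans (weight_smul_weightRatio_smul k y x _)
  choose τ h1 h2 h3 using key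
  have hq : ∀ y : Rn n, Measure.QuasiMeasurePreserving (fun x : Rn n => x - y) volume volume :=
    fun y => (measurePreserving_sub_right volume y).quasiMeasurePreserving
  -- linearity of translation follows from its description almost everywhere
  refine ⟨fun y => LinearMap.mkContinuous
    { toFun := fun f => τ f y
      map_add' := fun f g => WeightedSpace.ext_ae ?_
      map_smul' := fun c f => WeightedSpace.ext_ae ?_ } (weight k y) fun f => h2 f y,
    fun y f => h1 f y, fun y f => h2 f y, h3⟩
  · filter_upwards [h1 (f + g) y, h1 f y, h1 g y, WeightedSpace.toFun_add (τ f y) (τ g y),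
      (hq y).ae_eq_comp (WeightedSpace.toFun_add f g)] with x e1 e2 e3 e4 e5
    rw [e1, e4, e2, e3]
    exact e5
  · filter_upwards [h1 (c • f) y, h1 f y, WeightedSpace.toFun_smul c (τ f y),
      (hq y).ae_eq_comp (WeightedSpace.toFun_smul c f)] with x e1 e2 e4 e5
    rw [e1]
    simp only [RingHom.id_apply]
    rw [e4, e2]
    exact e5

end Spaces

/-! ### Gaussian Laplace transforms -/

section GaussLaplace

universe u

variable {n : ℕ} {F : Type u} [NormedAddCommGroup F] [NormedSpace ℝ F]

/-- Any power of `1 + ‖y‖` is dominated by any growing Gaussian. -/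
theorem weight_le_exp {N c : ℝ} (hN : 0 ≤ N) (hc : 0 < c) (y : Rn n) :
    weight N y ≤ Real.exp (N ^ 2 / (4 * c)) * Real.exp (c * ‖y‖ ^ 2) := by
  rw [weight, Real.rpow_def_of_pos (one_add_norm_pos y), ← Real.exp_add, Real.exp_le_exp]
  have h1 : Real.log (1 + ‖y‖) ≤ ‖y‖ := by
    have := Real.log_le_sub_one_of_pos (one_add_norm_pos y)
    linarith
  have h2 : Real.log (1 + ‖y‖) * N ≤ ‖y‖ * N := mul_le_mul_of_nonneg_right h1 hN
  have h3 : ‖y‖ * N = N ^ 2 / (4 * c) + c * ‖y‖ ^ 2 - c * (‖y‖ - N / (2 * c)) ^ 2 := by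
    field_simp
    ring
  nlinarith [mul_nonneg hc.le (sq_nonneg (‖y‖ - N / (2 * c)))]

/-- Integrability against every decaying Gaussian: the natural domain of the Gauss–Poisson
integrals for all times. -/
def GaussIntegrable (f : Rn n → F) : Prop :=
  ∀ c : ℝ, 0 < c → Integrable fun y => Real.exp (-c * ‖y‖ ^ 2) • f y

theorem GaussIntegrable.aestronglyMeasurable {f : Rn n → F} (hf : GaussIntegrable f) :
    AEStronglyMeasurable f volume := by
  have h1 : Continuous fun y : Rn n => Real.exp (1 * ‖y‖ ^ 2) := by fun_prop
  have := h1.aestronglyMeasurable (μ := volume).smul (hf 1 one_pos).aestronglyMeasurable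
  refine this.congr (Eventually.of_forall fun y => ?_)
  simp only [Pi.smul_apply', smul_smul, ← Real.exp_add]
  simp

theorem GaussIntegrable.of_weight {f : Rn n → F} {N : ℝ} (hN : 0 ≤ N)
    (hf : Integrable fun y => weight (-N) y • f y) : GaussIntegrable f := by
  intro c hc
  have hm : AEStronglyMeasurable (fun y => Real.exp (-c * ‖y‖ ^ 2) • f y) volume := by
    have h1 : Continuous fun y : Rn n => Real.exp (-c * ‖y‖ ^ 2) * weight N y :=
      (by fun_prop : Continuous fun y : Rn n => Real.exp (-c * ‖y‖ ^ 2)).mul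
        (continuous_weight N)
    refine (h1.aestronglyMeasurable (μ := volume).smul hf.aestronglyMeasurable).congr
      (Eventually.of_forall fun y => ?_)
    simp only [Pi.smul_apply', smul_smul, mul_assoc, weight_mul_weight]
    simp [weight]
  refine (hf.norm.const_mul (Real.exp (N ^ 2 / (4 * c)))).mono' hm (Eventually.of_forall fun y => ?_)
  have h2 := weight_le_exp hN hc y
  have h3 : weight N y * weight (-N) y = 1 := by
    rw [weight_mul_weight]; simp [weight]
  rw [norm_smul, norm_smul, Real.norm_of_nonneg (Real.exp_pos _).le,
    Real.norm_of_nonneg (weight_pos _ y).le, ← mul_assoc]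
  refine mul_le_mul_of_nonneg_right ?_ (norm_nonneg _)
  have h4 : Real.exp (-c * ‖y‖ ^ 2) * Real.exp (c * ‖y‖ ^ 2) = 1 := by
    rw [← Real.exp_add]; simp
  have h5 := weight_pos (-N) y
  have h6 := Real.exp_pos (-c * ‖y‖ ^ 2)
  calc Real.exp (-c * ‖y‖ ^ 2)
      = Real.exp (-c * ‖y‖ ^ 2) * (weight N y * weight (-N) y) := by rw [h3, mul_one]
    _ ≤ Real.exp (-c * ‖y‖ ^ 2) * (Real.exp (N ^ 2 / (4 * c)) * Real.exp (c * ‖y‖ ^ 2)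
          * weight (-N) y) := by gcongr
    _ = Real.exp (N ^ 2 / (4 * c)) * weight (-N) y
          * (Real.exp (-c * ‖y‖ ^ 2) * Real.exp (c * ‖y‖ ^ 2)) := by ring
    _ = _ := by rw [h4, mul_one]

/-- The linear form `(s, ξ) ↦ ⟪y, ξ⟫ - s ‖y‖²`. -/
def expForm (y : Rn n) : ℝ × Rn n →L[ℝ] ℝ :=
  (innerSL ℝ y).comp (ContinuousLinearMap.snd ℝ ℝ (Rn n)) -
    ‖y‖ ^ 2 • ContinuousLinearMap.fst ℝ ℝ (Rn n)

theorem expForm_apply (y : Rn n) (θ : ℝ × Rn n) :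
    expForm y θ = inner ℝ y θ.2 - θ.1 * ‖y‖ ^ 2 := by
  simp [expForm, mul_comm]

theorem continuous_expForm : Continuous (expForm : Rn n → ℝ × Rn n →L[ℝ] ℝ) := by
  unfold expForm
  fun_prop

theorem norm_expForm_le (y : Rn n) : ‖expForm y‖ ≤ weight 2 y := by
  refine ContinuousLinearMap.opNorm_le_bound _ (weight_pos 2 y).le fun θ => ?_
  rw [expForm_apply]
  have h1 : |inner ℝ y θ.2| ≤ ‖y‖ * ‖θ‖ :=
    (abs_real_inner_le_norm _ _).trans
      (mul_le_mul_of_nonneg_left (norm_snd_le θ) (norm_nonneg y))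
  have h2 : |θ.1 * ‖y‖ ^ 2| ≤ ‖θ‖ * ‖y‖ ^ 2 := by
    rw [abs_mul, abs_of_nonneg (sq_nonneg ‖y‖)]
    exact mul_le_mul_of_nonneg_right (norm_fst_le θ) (sq_nonneg _)
  have h3 : weight 2 y = (1 + ‖y‖) ^ 2 := by
    unfold weight
    exact_mod_cast Real.rpow_natCast (1 + ‖y‖) 2
  rw [h3, Real.norm_eq_abs]
  refine (abs_sub _ _).trans ?_
  nlinarith [norm_nonneg y, norm_nonneg θ, mul_nonneg (norm_nonneg y) (norm_nonneg θ)]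

/-- The transform `(s, ξ) ↦ ∫ exp(⟪y, ξ⟫ - s ‖y‖²) f(y) dy`. Completing the square turns the
Gauss–Poisson integral into this form, in which the parameters enter through a linear form. -/
def gaussLaplace (f : Rn n → F) (θ : ℝ × Rn n) : F := ∫ y, Real.exp (expForm y θ) • f y

/-- Locally uniformly in `(s, ξ)` with `s > 0`, the exponential is dominated by a Gaussian. -/
theorem exists_exp_expForm_le {θ₀ : ℝ × Rn n} (h : 0 < θ₀.1) : ∃ C c : ℝ, 0 < c ∧
    ∀ θ ∈ Metric.ball θ₀ (θ₀.1 / 2), ∀ y,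
      Real.exp (expForm y θ) ≤ C * Real.exp (-c * ‖y‖ ^ 2) := by
  set R := ‖θ₀.2‖ + θ₀.1 / 2 with hR
  refine ⟨Real.exp (R ^ 2 / θ₀.1), θ₀.1 / 4, by positivity, fun θ hθ y => ?_⟩
  rw [← Real.exp_add, Real.exp_le_exp, expForm_apply]
  rw [mem_ball_iff_norm] at hθ
  have h1 : |θ.1 - θ₀.1| < θ₀.1 / 2 := (norm_fst_le (θ - θ₀)).trans_lt hθ
  have h2 : ‖θ.2 - θ₀.2‖ < θ₀.1 / 2 := (norm_snd_le (θ - θ₀)).trans_lt hθ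
  have h3 : ‖θ.2‖ ≤ R := by
    have := norm_le_norm_add_norm_sub' θ.2 θ₀.2
    linarith
  have h4 : θ₀.1 / 2 ≤ θ.1 := by linarith [(abs_lt.1 h1).1]
  have h5 : inner ℝ y θ.2 ≤ ‖y‖ * R :=
    (real_inner_le_norm _ _).trans (mul_le_mul_of_nonneg_left h3 (norm_nonneg y))
  have h6 : θ₀.1 / 2 * ‖y‖ ^ 2 ≤ θ.1 * ‖y‖ ^ 2 :=
    mul_le_mul_of_nonneg_right h4 (sq_nonneg _)
  have h7 : ‖y‖ * R = R ^ 2 / θ₀.1 + θ₀.1 / 4 * ‖y‖ ^ 2 -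
      θ₀.1 / 4 * (‖y‖ - 2 * R / θ₀.1) ^ 2 := by
    field_simp
    ring
  nlinarith [mul_nonneg (by positivity : 0 ≤ θ₀.1 / 4) (sq_nonneg (‖y‖ - 2 * R / θ₀.1))]

theorem GaussIntegrable.integrable_exp_expForm {f : Rn n → F} (hf : GaussIntegrable f)
    {θ : ℝ × Rn n} (h : 0 < θ.1) : Integrable fun y => Real.exp (expForm y θ) • f y := by
  obtain ⟨C, c, hc, hb⟩ := exists_exp_expForm_le h
  have hcont : Continuous fun y : Rn n => Real.exp (expForm y θ) :=
    Real.continuous_exp.comp (continuous_expForm.clm_apply continuous_const)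
  refine ((hf c hc).norm.const_mul C).mono'
    (hcont.aestronglyMeasurable.smul hf.aestronglyMeasurable) (Eventually.of_forall fun y => ?_)
  rw [norm_smul, norm_smul, Real.norm_of_nonneg (Real.exp_pos _).le,
    Real.norm_of_nonneg (Real.exp_pos _).le, ← mul_assoc]
  exact mul_le_mul_of_nonneg_right (hb θ (Metric.mem_ball_self (half_pos h)) y) (norm_nonneg _)

/-- The class of Gauss integrable functions is stable under the operation that differentiates
the Gaussian Laplace transform. -/
theorem GaussIntegrable.expForm_smulRight {f : Rn n → F} (hf : GaussIntegrable f) :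
    GaussIntegrable fun y => (expForm y).smulRight (f y) := by
  intro c hc
  have hm : AEStronglyMeasurable (fun y => (expForm y).smulRight (f y)) volume :=
    (ContinuousLinearMap.smulRightL ℝ (ℝ × Rn n) F).aestronglyMeasurable_comp₂
      continuous_expForm.aestronglyMeasurable hf.aestronglyMeasurable
  have hcont : Continuous fun y : Rn n => Real.exp (-c * ‖y‖ ^ 2) := by fun_prop
  refine ((hf (c / 2) (half_pos hc)).norm.const_mul (Real.exp (2 ^ 2 / (4 * (c / 2))))).mono'
    (hcont.aestronglyMeasurable.smul hm) (Eventually.of_forall fun y => ?_)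
  rw [norm_smul, norm_smul, ContinuousLinearMap.norm_smulRight_apply,
    Real.norm_of_nonneg (Real.exp_pos _).le, Real.norm_of_nonneg (Real.exp_pos _).le,
    ← mul_assoc, ← mul_assoc]
  refine mul_le_mul_of_nonneg_right ?_ (norm_nonneg _)
  have h1 := (norm_expForm_le y).trans (weight_le_exp zero_le_two (half_pos hc) y)
  calc Real.exp (-c * ‖y‖ ^ 2) * ‖expForm y‖
      ≤ Real.exp (-c * ‖y‖ ^ 2) *
          (Real.exp (2 ^ 2 / (4 * (c / 2))) * Real.exp (c / 2 * ‖y‖ ^ 2)) := by gcongr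
    _ = Real.exp (2 ^ 2 / (4 * (c / 2))) *
          (Real.exp (-c * ‖y‖ ^ 2) * Real.exp (c / 2 * ‖y‖ ^ 2)) := by ring
    _ = _ := by
      rw [← Real.exp_add]
      congr 2
      ring

theorem hasFDerivAt_gaussLaplace {f : Rn n → F} (hf : GaussIntegrable f) {θ : ℝ × Rn n}
    (h : 0 < θ.1) : HasFDerivAt (gaussLaplace f)
      (gaussLaplace (fun y => (expForm y).smulRight (f y)) θ) θ := by
  obtain ⟨C, c, hc, hb⟩ := exists_exp_expForm_le h
  have hf' := hf.expForm_smulRight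
  have hcont : ∀ θ : ℝ × Rn n, Continuous fun y : Rn n => Real.exp (expForm y θ) := fun θ =>
    Real.continuous_exp.comp (continuous_expForm.clm_apply continuous_const)
  refine hasFDerivAt_integral_of_dominated_of_fderiv_le
    (bound := fun y => C * ‖Real.exp (-c * ‖y‖ ^ 2) • (expForm y).smulRight (f y)‖)
    (F' := fun θ y => Real.exp (expForm y θ) • (expForm y).smulRight (f y))
    (Metric.ball_mem_nhds θ (half_pos h)) (Eventually.of_forall fun η =>
      (hcont η).aestronglyMeasurable.smul hf.aestronglyMeasurable)
    (hf.integrable_exp_expForm h)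
    ((hcont θ).aestronglyMeasurable.smul hf'.aestronglyMeasurable)
    (Eventually.of_forall fun y η hη => ?_) ((hf' c hc).norm.const_mul C)
    (Eventually.of_forall fun y η _ => ?_)
  · rw [norm_smul, norm_smul, Real.norm_of_nonneg (Real.exp_pos _).le,
      Real.norm_of_nonneg (Real.exp_pos _).le, ← mul_assoc]
    exact mul_le_mul_of_nonneg_right (hb η hη y) (norm_nonneg _)
  · refine ((expForm y).hasFDerivAt.exp.smul_const (f y)).congr_fderiv ?_
    ext z <;> simp [smul_smul]

/-- The induction runs over all target spaces at once, as differentiation replaces `F` by a space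
of linear maps into `F`. -/
theorem contDiffAt_gaussLaplace_nat (m : ℕ) : ∀ {F : Type u} [NormedAddCommGroup F]
    [NormedSpace ℝ F] {f : Rn n → F}, GaussIntegrable f → ∀ {θ : ℝ × Rn n}, 0 < θ.1 →
      ContDiffAt ℝ m (gaussLaplace f) θ := by
  induction m with
  | zero =>
    intro F _ _ f hf θ h
    refine contDiffAt_zero.2 ⟨{η | 0 < η.1}, (isOpen_lt continuous_const continuous_fst).mem_nhds h,
      fun η hη => (hasFDerivAt_gaussLaplace hf hη).continuousAt.continuousWithinAt⟩
  | succ m ih =>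
    intro F _ _ f hf θ h
    rw [Nat.cast_succ, contDiffAt_succ_iff_hasFDerivAt]
    exact ⟨_, ⟨{η | 0 < η.1}, (isOpen_lt continuous_const continuous_fst).mem_nhds h,
      fun η hη => hasFDerivAt_gaussLaplace hf hη⟩, ih hf.expForm_smulRight h⟩

theorem contDiffAt_gaussLaplace {f : Rn n → F} (hf : GaussIntegrable f) {θ : ℝ × Rn n}
    (h : 0 < θ.1) : ContDiffAt ℝ ∞ (gaussLaplace f) θ :=
  contDiffAt_infty.2 fun m => contDiffAt_gaussLaplace_nat m hf h

/-! ### The heat kernel -/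

/-- The Gauss–Weierstrass kernel `(4πt)^(-n/2) exp(-‖y‖² / 4t)`. -/
def heatKernel (t : ℝ) (y : Rn n) : ℝ :=
  (4 * Real.pi * t) ^ (-(n : ℝ) / 2) * Real.exp (-‖y‖ ^ 2 / (4 * t))

/-- The time derivative of the heat kernel, which is also its Laplacian. -/
def heatKernelDeriv (t : ℝ) (y : Rn n) : ℝ :=
  (‖y‖ ^ 2 / (4 * t ^ 2) - n / (2 * t)) * heatKernel t y

theorem heatKernel_nonneg {t : ℝ} (ht : 0 ≤ t) (y : Rn n) : 0 ≤ heatKernel t y :=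
  mul_nonneg (Real.rpow_nonneg (by positivity) _) (Real.exp_pos _).le

theorem continuous_heatKernel (t : ℝ) : Continuous (heatKernel t : Rn n → ℝ) := by
  unfold heatKernel
  fun_prop

theorem continuous_heatKernelDeriv (t : ℝ) : Continuous (heatKernelDeriv t : Rn n → ℝ) := by
  unfold heatKernelDeriv heatKernel
  fun_prop

theorem exp_expForm_zero (t : ℝ) (y : Rn n) :
    Real.exp (expForm y (1 / (4 * t), 0)) = Real.exp (-‖y‖ ^ 2 / (4 * t)) := by
  rw [expForm_apply]
  congr 1
  simp
  ring

theorem GaussIntegrable.integrable_heatKernel_smul {f : Rn n → F} (hf : GaussIntegrable f) {t : ℝ}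
    (ht : 0 < t) : Integrable fun y => heatKernel t y • f y := by
  have := (hf.integrable_exp_expForm (θ := (1 / (4 * t), 0)) (by positivity)).smul
    ((4 * Real.pi * t) ^ (-(n : ℝ) / 2))
  refine this.congr (Eventually.of_forall fun y => ?_)
  simp only [Pi.smul_apply, exp_expForm_zero, heatKernel, smul_smul]

theorem integral_heatKernel_smul (f : Rn n → F) (t : ℝ) :
    ∫ y, heatKernel t y • f y =
      (4 * Real.pi * t) ^ (-(n : ℝ) / 2) • gaussLaplace f (1 / (4 * t), 0) := by
  rw [gaussLaplace, ← integral_smul]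
  refine integral_congr_ae (Eventually.of_forall fun y => ?_)
  simp only [exp_expForm_zero, heatKernel, smul_smul]

theorem contDiffOn_integral_heatKernel_smul {f : Rn n → F} (hf : GaussIntegrable f) :
    ContDiffOn ℝ ∞ (fun t => ∫ y, heatKernel t y • f y) (Ioi 0) := by
  intro t ht
  have ht' : (0 : ℝ) < t := ht
  simp_rw [integral_heatKernel_smul]
  refine ContDiffAt.contDiffWithinAt (ContDiffAt.smul ?_ ?_)
  · exact (contDiffAt_const.mul contDiffAt_id).rpow_const_of_ne (by positivity)
  · refine (contDiffAt_gaussLaplace hf (by positivity)).comp t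
      (ContDiffAt.prodMk ?_ contDiffAt_const)
    exact contDiffAt_const.div (contDiffAt_const.mul contDiffAt_id) (by positivity)

/-- The derivative of `t ↦ ∫ K_t(y) f(y) dy`, obtained from the Gaussian Laplace transform along
`t ↦ (1 / 4t, 0)`. -/
theorem hasDerivAt_integral_heatKernel_smul {f : Rn n → F} (hf : GaussIntegrable f) [CompleteSpace F]
    {t : ℝ} (ht : 0 < t) : Integrable (fun y => heatKernelDeriv t y • f y) ∧
    HasDerivAt (fun t => ∫ y, heatKernel t y • f y) (∫ y, heatKernelDeriv t y • f y) t := by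
  have hp : (0 : ℝ) < 1 / (4 * t) := by positivity
  have h1 : HasDerivAt (fun t : ℝ => (1 / (4 * t), (0 : Rn n))) (-1 / (4 * t ^ 2), 0) t := by
    refine HasDerivAt.prodMk ?_ (hasDerivAt_const _ _)
    have := ((hasDerivAt_id t).const_mul (4 : ℝ)).inv (by simpa using ht.ne')
    simp only [one_div]
    refine this.congr_deriv ?_
    simp only [id, mul_one]
    field_simp
  have h2 := (hasFDerivAt_gaussLaplace hf (θ := (1 / (4 * t), 0)) hp).comp_hasDerivAt t h1
  have h3 : HasDerivAt (fun t : ℝ => (4 * Real.pi * t) ^ (-(n : ℝ) / 2))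
      (4 * Real.pi * (-(n : ℝ) / 2) * (4 * Real.pi * t) ^ (-(n : ℝ) / 2 - 1)) t := by
    have := ((hasDerivAt_id t).const_mul (4 * Real.pi)).rpow_const (p := -(n : ℝ) / 2)
      (Or.inl (by simp [Real.pi_ne_zero, ht.ne']))
    simpa using this
  have hi := hf.expForm_smulRight.integrable_exp_expForm (θ := (1 / (4 * t), 0)) hp
  have h4 : Integrable fun y => heatKernelDeriv t y • f y := by
    have a := ((hi.apply_continuousLinearMap (-1 / (4 * t ^ 2), (0 : Rn n))).smul
      ((4 * Real.pi * t) ^ (-(n : ℝ) / 2))).add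
      ((hf.integrable_heatKernel_smul ht).smul (-(n / (2 * t) : ℝ)))
    refine a.congr (Eventually.of_forall fun y => ?_)
    simp only [Pi.add_apply, Pi.smul_apply, smul_apply,
      ContinuousLinearMap.smulRight_apply, exp_expForm_zero, heatKernelDeriv, heatKernel]
    simp only [expForm_apply, smul_smul, ← add_smul, inner_zero_right]
    congr 1
    ring
  refine ⟨h4, ?_⟩
  have h5 := h3.smul h2
  simp_rw [integral_heatKernel_smul]
  refine h5.congr_deriv ?_
  simp only [Function.comp_apply]
  rw [gaussLaplace, ContinuousLinearMap.integral_apply hi, gaussLaplace, ← integral_smul,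
    ← integral_smul, ← integral_add]
  · refine integral_congr_ae (Eventually.of_forall fun y => ?_)
    simp only [smul_apply, ContinuousLinearMap.smulRight_apply, exp_expForm_zero,
      heatKernelDeriv, heatKernel]
    simp only [expForm_apply, smul_smul, ← add_smul, inner_zero_right]
    congr 1
    rw [Real.rpow_sub_one (by positivity)]
    field_simp
    ring
  · exact (hi.apply_continuousLinearMap _).smul _
  · exact (hf.integrable_exp_expForm hp).smul _

/-! ### Smoothness of the Gauss–Poisson integral -/

/-- Completing the square. -/
theorem exp_sq_norm_sub {t : ℝ} (x y : Rn n) :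
    Real.exp (-‖x - y‖ ^ 2 / (4 * t)) = Real.exp (-‖x‖ ^ 2 / (4 * t)) *
      Real.exp (expForm y (1 / (4 * t), (1 / (2 * t)) • x)) := by
  rw [expForm_apply, ← Real.exp_add]
  congr 1
  rw [norm_sub_sq_real, inner_smul_right, real_inner_comm]
  by_cases ht : t = 0
  · simp [ht]
  · field_simp
    ring

end GaussLaplace

section GaussPoisson

variable {n : ℕ} {Y : Type*} [NormedAddCommGroup Y] [NormedSpace ℂ Y]

theorem GaussIntegrable.integrable_gaussIntegrand {f : Rn n → Y} (hf : GaussIntegrable f) {t : ℝ}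
    (ht : 0 < t) (x : Rn n) : Integrable (gaussIntegrand t f x) := by
  have h1 := (hf.integrable_exp_expForm (θ := (1 / (4 * t), (1 / (2 * t)) • x))
    (by positivity)).smul (Real.exp (-‖x‖ ^ 2 / (4 * t)))
  have h2 : Integrable fun y => Real.exp (-‖x - y‖ ^ 2 / (4 * t)) • f y := by
    refine h1.congr (Eventually.of_forall fun y => ?_)
    simp only [Pi.smul_apply, exp_sq_norm_sub, smul_smul]
  refine (h2.comp_sub_left x).congr (Eventually.of_forall fun y => ?_)
  simp [gaussIntegrand]

theorem gaussPoisson_eq_integral (f : Rn n → Y) (t : ℝ) (x : Rn n) :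
    gaussPoisson t f x = ∫ y, heatKernel t y • f (x - y) := by
  rw [gaussPoisson, ← integral_smul]
  simp only [gaussIntegrand, heatKernel, smul_smul]

theorem gaussPoisson_eq_gaussLaplace (f : Rn n → Y) (t : ℝ) (x : Rn n) :
    gaussPoisson t f x = ((4 * Real.pi * t) ^ (-(n : ℝ) / 2) * Real.exp (-‖x‖ ^ 2 / (4 * t))) •
      gaussLaplace f (1 / (4 * t), (1 / (2 * t)) • x) := by
  have h : ∫ y, gaussIntegrand t f x y = ∫ y, Real.exp (-‖x - y‖ ^ 2 / (4 * t)) • f y := by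
    rw [← integral_sub_left_eq_self _ volume x]
    simp [gaussIntegrand]
  rw [gaussPoisson, h, mul_smul, gaussLaplace, ← integral_smul (Real.exp _)]
  simp_rw [exp_sq_norm_sub, mul_smul]

theorem contDiffOn_gaussPoisson {f : Rn n → Y} (hf : GaussIntegrable f) :
    ContDiffOn ℝ ∞ (fun z : ℝ × Rn n => gaussPoisson z.1 f z.2) (openHalfSpace n) := by
  intro z hz
  have hz' : (0 : ℝ) < z.1 := hz.1
  simp_rw [gaussPoisson_eq_gaussLaplace]
  have h4 : 4 * z.1 ≠ 0 := by positivity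
  have h1 : ContDiffAt ℝ ∞ (fun z : ℝ × Rn n =>
      (4 * Real.pi * z.1) ^ (-(n : ℝ) / 2) * Real.exp (-‖z.2‖ ^ 2 / (4 * z.1))) z :=
    ((contDiffAt_const.mul contDiffAt_fst).rpow_const_of_ne (by positivity)).mul
      ((contDiffAt_snd.norm_sq ℝ).neg.div (contDiffAt_const.mul contDiffAt_fst) h4).exp
  have h0 : ContDiffAt ℝ ∞ (fun z : ℝ × Rn n => 1 / (2 * z.1)) z :=
    contDiffAt_const.div (contDiffAt_const.mul contDiffAt_fst) (by positivity)
  have h2 : ContDiffAt ℝ ∞ (fun z : ℝ × Rn n => (1 / (4 * z.1), (1 / (2 * z.1)) • z.2)) z :=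
    ContDiffAt.prodMk (contDiffAt_const.div (contDiffAt_const.mul contDiffAt_fst) h4)
      (h0.smul contDiffAt_snd)
  exact (h1.smul ((contDiffAt_gaussLaplace hf (by positivity)).comp z h2)).contDiffWithinAt

end GaussPoisson

/-! ### Test functions and integration by parts -/

section TestFunctions

variable {n : ℕ} {F : Type*} [NormedAddCommGroup F] [NormedSpace ℝ F]

theorem partialDeriv_eq_fderiv {φ : Rn n → F} (hφ : Differentiable ℝ φ) (j : Fin n) :
    partialDeriv j φ = fun x => fderiv ℝ φ x (EuclideanSpace.single j 1) :=
  funext fun x => (hφ x).lineDeriv_eq_fderiv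

theorem contDiff_partialDeriv {φ : Rn n → F} (hφ : ContDiff ℝ ∞ φ) (j : Fin n) :
    ContDiff ℝ ∞ (partialDeriv j φ) := by
  rw [partialDeriv_eq_fderiv (hφ.differentiable (by simp))]
  exact (hφ.fderiv_right (by simp)).clm_apply contDiff_const

theorem hasCompactSupport_partialDeriv {φ : Rn n → F} (hφ : ContDiff ℝ ∞ φ)
    (hc : HasCompactSupport φ) (j : Fin n) : HasCompactSupport (partialDeriv j φ) := by
  rw [partialDeriv_eq_fderiv (hφ.differentiable (by simp))]
  exact hc.fderiv_apply ℝ _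

theorem contDiff_laplace {φ : Rn n → F} (hφ : ContDiff ℝ ∞ φ) : ContDiff ℝ ∞ (laplace φ) :=
  ContDiff.sum fun j _ => contDiff_partialDeriv (contDiff_partialDeriv hφ j) j

theorem hasCompactSupport_laplace {φ : Rn n → F} (hφ : ContDiff ℝ ∞ φ)
    (hc : HasCompactSupport φ) : HasCompactSupport (laplace φ) := by
  have : laplace φ = ∑ j : Fin n, partialDeriv j (partialDeriv j φ) := by
    funext x
    simp [laplace]
  rw [this]
  refine Finset.sum_induction _ HasCompactSupport (fun a b => HasCompactSupport.add)
    HasCompactSupport.zero fun j _ => ?_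
  exact hasCompactSupport_partialDeriv (contDiff_partialDeriv hφ j)
    (hasCompactSupport_partialDeriv hφ hc j) j

theorem partialDeriv_comp_add_right (φ : Rn n → F) (y : Rn n) (j : Fin n) :
    partialDeriv j (fun x => φ (x + y)) = fun x => partialDeriv j φ (x + y) := by
  funext x
  simp only [partialDeriv, lineDeriv, add_right_comm]

theorem laplace_comp_add_right (φ : Rn n → F) (y : Rn n) :
    laplace (fun x => φ (x + y)) = fun x => laplace φ (x + y) := by
  funext x
  simp only [laplace, partialDeriv_comp_add_right]

theorem integrable_smul_of_compactSupport {φ : Rn n → ℝ} (hφ : Continuous φ)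
    (hc : HasCompactSupport φ) {h : Rn n → F} (hh : Continuous h) :
    Integrable fun x => φ x • h x :=
  (hφ.smul hh).integrable_of_hasCompactSupport hc.smul_right

theorem integral_partialDeriv_smul {φ : Rn n → ℝ} (hφ : ContDiff ℝ ∞ φ)
    (hc : HasCompactSupport φ) (j : Fin n) {h : Rn n → F} (hh : Continuous h)
    (hd : ∀ x, LineDifferentiableAt ℝ h x (EuclideanSpace.single j 1))
    (hh' : Continuous (partialDeriv j h)) :
    ∫ x, partialDeriv j φ x • h x = -∫ x, φ x • partialDeriv j h x := by
  have := integral_bilinear_hasLineDerivAt_right_eq_neg_left_of_integrable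
    (B := ContinuousLinearMap.lsmul ℝ ℝ) (μ := (volume : Measure (Rn n))) (f := φ)
    (f' := partialDeriv j φ) (g := h) (g' := partialDeriv j h) (v := EuclideanSpace.single j 1)
    (integrable_smul_of_compactSupport (contDiff_partialDeriv hφ j).continuous
      (hasCompactSupport_partialDeriv hφ hc j) hh)
    (integrable_smul_of_compactSupport hφ.continuous hc hh')
    (integrable_smul_of_compactSupport hφ.continuous hc hh)
    (fun x _ => ((hφ.differentiable (by simp)) x).lineDifferentiableAt.hasLineDerivAt)
    (fun x _ => (hd x).hasLineDerivAt)
  simp only [ContinuousLinearMap.lsmul_apply] at this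
  rw [this, neg_neg]

/-- Green's formula against a test function, for functions with continuous second partial
derivatives in each coordinate direction. -/
theorem integral_laplace_smul {φ : Rn n → ℝ} (hφ : ContDiff ℝ ∞ φ) (hc : HasCompactSupport φ)
    {h : Rn n → F} (hh : Continuous h)
    (hd : ∀ j x, LineDifferentiableAt ℝ h x (EuclideanSpace.single j 1))
    (hh' : ∀ j, Continuous (partialDeriv j h))
    (hd' : ∀ j x, LineDifferentiableAt ℝ (partialDeriv j h) x (EuclideanSpace.single j 1))
    (hh'' : ∀ j, Continuous (partialDeriv j (partialDeriv j h))) :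
    ∫ x, laplace φ x • h x = ∫ x, φ x • laplace h x := by
  simp only [laplace, Finset.sum_smul, Finset.smul_sum]
  rw [integral_finsetSum, integral_finsetSum]
  · refine Finset.sum_congr rfl fun j _ => ?_
    rw [integral_partialDeriv_smul (contDiff_partialDeriv hφ j)
      (hasCompactSupport_partialDeriv hφ hc j) j hh (hd j) (hh' j),
      integral_partialDeriv_smul hφ hc j (hh' j) (hd' j) (hh'' j), neg_neg]
  · exact fun j _ => integrable_smul_of_compactSupport hφ.continuous hc (hh'' j)
  · exact fun j _ => integrable_smul_of_compactSupport
      (contDiff_partialDeriv (contDiff_partialDeriv hφ j) j).continuous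
      (hasCompactSupport_partialDeriv (contDiff_partialDeriv hφ j)
        (hasCompactSupport_partialDeriv hφ hc j) j) hh

theorem contDiff_heatKernel (t : ℝ) : ContDiff ℝ ∞ (heatKernel t : Rn n → ℝ) := by
  unfold heatKernel
  exact contDiff_const.mul ((contDiff_norm_sq ℝ).neg.div_const _).exp

theorem hasLineDerivAt_heatKernel (t : ℝ) (y : Rn n) (j : Fin n) :
    HasLineDerivAt ℝ (heatKernel t) (-(y j / (2 * t)) * heatKernel t y) y
      (EuclideanSpace.single j 1) := by
  have h := (((((hasStrictFDerivAt_norm_sq y).hasFDerivAt.neg).mul_const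
    ((4 * t)⁻¹)).exp).const_mul ((4 * Real.pi * t) ^ (-(n : ℝ) / 2))).hasLineDerivAt
      (EuclideanSpace.single j (1 : ℝ))
  convert! h using 1
  simp [heatKernel, EuclideanSpace.inner_single_right, div_eq_mul_inv]
  ring

theorem partialDeriv_heatKernel (t : ℝ) (j : Fin n) :
    partialDeriv j (heatKernel t : Rn n → ℝ) = fun y => -(y j / (2 * t)) * heatKernel t y :=
  funext fun y => (hasLineDerivAt_heatKernel t y j).lineDeriv

theorem partialDeriv_partialDeriv_heatKernel (t : ℝ) (j : Fin n) (y : Rn n) :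
    partialDeriv j (partialDeriv j (heatKernel t : Rn n → ℝ)) y =
      ((y j) ^ 2 / (4 * t ^ 2) - 1 / (2 * t)) * heatKernel t y := by
  rw [partialDeriv_heatKernel]
  have h1 : HasLineDerivAt ℝ (fun y : Rn n => -(y j / (2 * t))) (-(1 / (2 * t))) y
      (EuclideanSpace.single j 1) := by
    have := ((EuclideanSpace.proj j : Rn n →L[ℝ] ℝ).hasFDerivAt (x := y)).hasLineDerivAt
      (EuclideanSpace.single j (1 : ℝ))
    have h2 : HasDerivAt (fun s : ℝ => (y + s • EuclideanSpace.single j (1 : ℝ)) j) 1 0 := by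
      simpa [HasLineDerivAt] using this
    exact (h2.div_const (2 * t)).neg
  have h2 := HasDerivAt.mul h1 (hasLineDerivAt_heatKernel t y j)
  refine (HasDerivAt.deriv h2).trans ?_
  simp
  ring

theorem laplace_heatKernel (t : ℝ) : laplace (heatKernel t : Rn n → ℝ) = heatKernelDeriv t := by
  funext y
  simp only [laplace, partialDeriv_partialDeriv_heatKernel, heatKernelDeriv]
  rw [← Finset.sum_mul, Finset.sum_sub_distrib, ← Finset.sum_div, ← EuclideanSpace.real_norm_sq_eq]
  simp
  ring_nf
  simp

theorem integral_laplace_mul_heatKernel {φ : Rn n → ℝ} (hφ : ContDiff ℝ ∞ φ)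
    (hc : HasCompactSupport φ) (t : ℝ) (z : Rn n) :
    ∫ y, laplace φ (z + y) * heatKernel t y = ∫ y, φ (z + y) * heatKernelDeriv t y := by
  have hK := contDiff_heatKernel (n := n) t
  have h := integral_laplace_smul (φ := fun y => φ (y + z)) (h := (heatKernel t : Rn n → ℝ))
    (hφ.comp (contDiff_id.add contDiff_const))
    (hc.comp_homeomorph (Homeomorph.addRight z)) hK.continuous
    (fun j x => ((hK.differentiable (by simp)) x).lineDifferentiableAt)
    (fun j => (contDiff_partialDeriv hK j).continuous)
    (fun j x => (((contDiff_partialDeriv hK j).differentiable (by simp)) x).lineDifferentiableAt)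
    (fun j => (contDiff_partialDeriv (contDiff_partialDeriv hK j) j).continuous)
  rw [laplace_comp_add_right, laplace_heatKernel] at h
  simpa only [add_comm z, smul_eq_mul] using h

end TestFunctions

/-! ### Pairings with test functions and Fubini's theorem -/

section Pairing

variable {n : ℕ} {F : Type*} [NormedAddCommGroup F] [NormedSpace ℝ F]

theorem exists_abs_le_weight_neg {φ : Rn n → ℝ} (hφ : Continuous φ) (hc : HasCompactSupport φ)
    (N : ℝ) : ∃ C : ℝ, 0 ≤ C ∧ ∀ x, |φ x| ≤ C * weight (-N) x := by
  obtain ⟨C, hC⟩ := (hφ.mul (continuous_weight N)).bounded_above_of_compact_support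
    (f := fun x => φ x * weight N x) hc.mul_right
  refine ⟨C, (norm_nonneg _).trans (hC 0), fun x => ?_⟩
  have h1 : weight N x * weight (-N) x = 1 := by
    rw [weight_mul_weight]; simp [weight]
  have h2 := mul_le_mul_of_nonneg_right (hC x) (weight_pos (-N) x).le
  rw [norm_mul, Real.norm_of_nonneg (weight_pos N x).le, mul_assoc, h1, mul_one] at h2
  exact h2

theorem weight_neg_add_le {N : ℝ} (hN : 0 ≤ N) (z y : Rn n) :
    weight (-N) (z + y) ≤ weight (-N) z * weight N y := by
  have h0 : ∀ x : Rn n, weight (-N) x = (weight N x)⁻¹ := fun x =>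
    Real.rpow_neg (one_add_norm_pos x).le N
  have h1 : weight N z ≤ weight N (z + y) * weight N y := by
    have := weight_add_le hN (z + y) (-y)
    rwa [add_neg_cancel_right, weight_neg] at this
  rw [h0, h0, inv_mul_eq_div, le_div_iff₀ (weight_pos N z), inv_mul_eq_div,
    div_le_iff₀ (weight_pos N _), mul_comm]
  exact h1

theorem integrable_smul_of_weight {N : ℝ} {f : Rn n → F}
    (hf : Integrable fun x => weight (-N) x • f x) {φ : Rn n → ℝ} (hφ : Continuous φ)
    (hc : HasCompactSupport φ) : Integrable fun x => φ x • f x := by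
  have h1 : Continuous fun x => φ x * weight N x := hφ.mul (continuous_weight N)
  obtain ⟨C, hC⟩ := h1.bounded_above_of_compact_support hc.mul_right
  refine (hf.norm.const_mul C).mono' ?_ (Eventually.of_forall fun x => ?_)
  · refine (h1.aestronglyMeasurable.smul hf.aestronglyMeasurable).congr
      (Eventually.of_forall fun y => ?_)
    simp only [Pi.smul_apply', smul_smul, mul_assoc, weight_mul_weight]
    simp [weight]
  · have : φ x • f x = (φ x * weight N x) • weight (-N) x • f x := by
      rw [smul_smul, mul_assoc, weight_mul_weight]
      simp [weight]
    rw [this, norm_smul]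
    exact mul_le_mul_of_nonneg_right (hC x) (norm_nonneg _)

theorem locallyIntegrable_of_weight {N : ℝ} {f : Rn n → F}
    (hf : Integrable fun x => weight (-N) x • f x) : LocallyIntegrable f volume := by
  have h := hf.locallyIntegrable.continuous_smul (continuous_weight N)
  refine h.congr (Eventually.of_forall fun x => ?_)
  simp only [smul_smul, weight_mul_weight]
  simp [weight]

section Fubini

variable {N : ℝ} {f : Rn n → F} {φ a : Rn n → ℝ}

/-- Integrability behind the two applications of Fubini's theorem below: after the shear
`x = z + y`, the decay of `φ` is shared out between `f` and `a`. -/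
theorem integrable_prod_smul (hN : 0 ≤ N) (hf : Integrable fun x => weight (-N) x • f x)
    (hφ : Continuous φ) (hc : HasCompactSupport φ) (ha : Continuous a)
    (hai : Integrable fun y => weight N y * a y) :
    Integrable (fun p : Rn n × Rn n => (φ (p.1 + p.2) * a p.2) • f p.1)
      (volume.prod volume) := by
  obtain ⟨C, hC0, hC⟩ := exists_abs_le_weight_neg hφ hc N
  have hfm : AEStronglyMeasurable f volume := (locallyIntegrable_of_weight hf).aestronglyMeasurable
  have h1 : Continuous fun p : Rn n × Rn n => φ (p.1 + p.2) * a p.2 := by fun_prop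
  refine ((hf.norm.mul_prod hai.norm).const_mul C).mono'
    (h1.aestronglyMeasurable.smul hfm.comp_fst) (Eventually.of_forall fun p => ?_)
  rw [norm_smul, norm_mul, norm_smul, norm_mul, Real.norm_of_nonneg (weight_pos _ _).le,
    Real.norm_of_nonneg (weight_pos _ _).le]
  have h2 : ‖φ (p.1 + p.2)‖ ≤ C * (weight (-N) p.1 * weight N p.2) :=
    (hC _).trans (mul_le_mul_of_nonneg_left (weight_neg_add_le hN _ _) hC0)
  calc ‖φ (p.1 + p.2)‖ * ‖a p.2‖ * ‖f p.1‖
      ≤ C * (weight (-N) p.1 * weight N p.2) * ‖a p.2‖ * ‖f p.1‖ := by gcongr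
    _ = _ := by ring

theorem integral_smul_integral_translate [CompleteSpace F] (hN : 0 ≤ N)
    (hf : Integrable fun x => weight (-N) x • f x)
    (hφ : Continuous φ) (hc : HasCompactSupport φ) (ha : Continuous a)
    (hai : Integrable fun y => weight N y * a y) :
    ∫ y, a y • ∫ x, φ x • f (x - y) = ∫ z, (∫ y, φ (z + y) * a y) • f z := by
  have h := integral_integral_swap (f := fun z y => (φ (z + y) * a y) • f z)
    (integrable_prod_smul hN hf hφ hc ha hai)
  simp only [integral_smul_const] at h
  rw [h]
  refine integral_congr_ae (Eventually.of_forall fun y => ?_)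
  change a y • ∫ x, φ x • f (x - y) = ∫ x, (φ (x + y) * a y) • f x
  rw [← integral_smul, ← integral_sub_right_eq_self (fun x => (φ (x + y) * a y) • f x) y]
  simp only [sub_add_cancel, mul_smul, smul_comm (a y)]

theorem integral_smul_integral_convolve (hN : 0 ≤ N)
    (hf : Integrable fun x => weight (-N) x • f x)
    (hφ : Continuous φ) (hc : HasCompactSupport φ) (ha : Continuous a)
    (hai : Integrable fun y => weight N y * a y) :
    ∫ y, a y • ∫ x, φ x • f (x - y) = ∫ x, φ x • ∫ y, a y • f (x - y) := by
  have h := (measurePreserving_sub_prod (volume : Measure (Rn n)) volume).integrable_comp_of_integrable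
    (integrable_prod_smul hN hf hφ hc ha hai)
  have h2 : Integrable (Function.uncurry fun x y : Rn n => φ x • a y • f (x - y))
      (volume.prod volume) := by
    refine h.congr (Eventually.of_forall fun p => ?_)
    simp [Function.uncurry, mul_smul]
  simp only [← integral_smul]
  rw [integral_integral_swap h2]
  simp only [smul_comm (φ _)]

end Fubini

end Pairing

/-! ### Pairings and translations on `wX` -/

section Semigroup

variable {n : ℕ} {Y : Type*} [NormedAddCommGroup Y] [NormedSpace ℂ Y] {κ : SpaceKind} {k : ℝ}

theorem WeightedSpace.integrable_weight_smul (f : WeightedSpace n Y κ k) :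
    Integrable fun x => weight (-(k + n + 1)) x • f.toFun x := by
  obtain ⟨C, hC⟩ := WeightedSpace.exists_integral_bound n Y κ k
  exact (hC f).1

theorem add_natCast_add_one_nonneg (n : ℕ) (hk : 0 ≤ k) : 0 ≤ k + n + 1 := by positivity

theorem WeightedSpace.gaussIntegrable_toFun (hk : 0 ≤ k) (f : WeightedSpace n Y κ k) :
    GaussIntegrable f.toFun :=
  GaussIntegrable.of_weight (add_natCast_add_one_nonneg n hk) f.integrable_weight_smul

/-- Pairing with a continuous compactly supported function is a continuous linear map on
`wX`. -/
theorem WeightedSpace.exists_pairing (κ : SpaceKind) (k : ℝ) {φ : Rn n → ℝ} (hφ : Continuous φ)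
    (hc : HasCompactSupport φ) :
    ∃ l : WeightedSpace n Y κ k →L[ℝ] Y, ∀ f, l f = ∫ x, φ x • f.toFun x := by
  obtain ⟨C, hC⟩ := WeightedSpace.exists_integral_bound n Y κ k
  obtain ⟨D, hD0, hD⟩ := exists_abs_le_weight_neg hφ hc (k + n + 1)
  have hi : ∀ f : WeightedSpace n Y κ k, Integrable fun x => φ x • f.toFun x := fun f =>
    integrable_smul_of_weight f.integrable_weight_smul hφ hc
  let L : WeightedSpace n Y κ k →ₗ[ℝ] Y :=
    { toFun := fun f => ∫ x, φ x • f.toFun x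
      map_add' := fun f g => by
        rw [← integral_add (hi f) (hi g)]
        refine integral_congr_ae ?_
        filter_upwards [WeightedSpace.toFun_add f g] with x hx
        rw [hx, smul_add]
      map_smul' := fun c f => by
        rw [RingHom.id_apply, ← integral_smul]
        refine integral_congr_ae ?_
        filter_upwards [WeightedSpace.toFun_smul c f] with x hx
        rw [hx, smul_comm] }
  refine ⟨L.mkContinuous (D * C) fun f => ?_, fun f => rfl⟩
  refine (norm_integral_le_integral_norm _).trans ?_
  rw [mul_assoc]
  refine le_trans ?_ (mul_le_mul_of_nonneg_left (hC f).2 hD0)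
  rw [← integral_const_mul]
  refine integral_mono (hi f).norm ((hC f).1.norm.const_mul D) fun x => ?_
  simp only [norm_smul, Real.norm_of_nonneg (weight_pos _ x).le, ← mul_assoc]
  exact mul_le_mul_of_nonneg_right (hD x) (norm_nonneg _)

theorem WeightedSpace.ext_test [CompleteSpace Y] {f g : WeightedSpace n Y κ k}
    (h : ∀ φ : Rn n → ℝ, ContDiff ℝ ∞ φ → HasCompactSupport φ →
      ∫ x, φ x • f.toFun x = ∫ x, φ x • g.toFun x) : f = g :=
  WeightedSpace.ext_ae (ae_eq_of_integral_contDiff_smul_eq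
    (locallyIntegrable_of_weight f.integrable_weight_smul)
    (locallyIntegrable_of_weight g.integrable_weight_smul) h)

theorem HasLaplacian.sub {f₁ f₂ g₁ g₂ : WeightedSpace n Y κ k} (h₁ : HasLaplacian f₁ g₁)
    (h₂ : HasLaplacian f₂ g₂) : HasLaplacian (f₁ - f₂) (g₁ - g₂) := by
  intro φ hφ hc
  obtain ⟨l, hl⟩ := WeightedSpace.exists_pairing (Y := Y) κ k hφ.continuous hc
  obtain ⟨m, hm⟩ := WeightedSpace.exists_pairing (Y := Y) κ k (contDiff_laplace hφ).continuous
    (hasCompactSupport_laplace hφ hc)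
  have e₁ := h₁ φ hφ hc
  have e₂ := h₂ φ hφ hc
  rw [← hl, ← hm] at e₁ e₂ ⊢
  rw [map_sub, map_sub, e₁, e₂]

/-- Translation by `y`, acting on `wX` by `f ↦ f(· - y)`. -/
def translation (hk : 0 ≤ k) : Rn n → WeightedSpace n Y κ k →L[ℝ] WeightedSpace n Y κ k :=
  (WeightedSpace.exists_translation n Y κ hk).choose

theorem toFun_translation (hk : 0 ≤ k) (y : Rn n) (f : WeightedSpace n Y κ k) :
    (translation hk y f).toFun =ᵐ[volume] fun x => f.toFun (x - y) :=
  (WeightedSpace.exists_translation n Y κ hk).choose_spec.1 y f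

theorem norm_translation_le (hk : 0 ≤ k) (y : Rn n) (f : WeightedSpace n Y κ k) :
    ‖translation hk y f‖ ≤ weight k y * ‖f‖ :=
  (WeightedSpace.exists_translation n Y κ hk).choose_spec.2.1 y f

theorem continuous_translation (hk : 0 ≤ k) (f : WeightedSpace n Y κ k) :
    Continuous fun y => translation hk y f :=
  (WeightedSpace.exists_translation n Y κ hk).choose_spec.2.2 f

theorem translation_zero (hk : 0 ≤ k) (f : WeightedSpace n Y κ k) :
    translation hk 0 f = f := by
  refine WeightedSpace.ext_ae ?_
  filter_upwards [toFun_translation hk 0 f] with x hx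
  rw [hx, sub_zero]

theorem HasLaplacian.translation (hk : 0 ≤ k) {f g : WeightedSpace n Y κ k}
    (h : HasLaplacian f g) (y : Rn n) :
    HasLaplacian (translation hk y f) (translation hk y g) := by
  intro φ hφ hc
  have key : ∀ (ψ : Rn n → ℝ) (f : WeightedSpace n Y κ k),
      ∫ x, ψ x • (WeightedHeat.translation hk y f).toFun x = ∫ x, ψ (x + y) • f.toFun x := by
    intro ψ f
    rw [← integral_sub_right_eq_self (fun x => ψ (x + y) • f.toFun x) y]
    refine integral_congr_ae ?_
    filter_upwards [toFun_translation hk y f] with x hx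
    rw [hx, sub_add_cancel]
  have := h (fun x => φ (x + y)) (hφ.comp (contDiff_id.add contDiff_const))
    (hc.comp_homeomorph (Homeomorph.addRight y))
  rw [laplace_comp_add_right] at this
  rw [key, key, this]

theorem gaussIntegrable_weight {N : ℝ} (hN : 0 ≤ N) : GaussIntegrable (weight N : Rn n → ℝ) := by
  refine GaussIntegrable.of_weight (add_natCast_add_one_nonneg n hN) ?_
  simp only [smul_eq_mul, weight_mul_weight]
  have : -(N + n + 1) + N = -((n : ℝ) + 1) := by ring
  rw [this]
  exact integrable_weight_neg (by simp)

theorem integrable_weight_mul_heatKernel {N : ℝ} (hN : 0 ≤ N) {t : ℝ} (ht : 0 < t) :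
    Integrable fun y : Rn n => weight N y * heatKernel t y := by
  simpa [mul_comm] using (gaussIntegrable_weight (n := n) hN).integrable_heatKernel_smul ht

theorem integrable_weight_mul_heatKernelDeriv {N : ℝ} (hN : 0 ≤ N) {t : ℝ} (ht : 0 < t) :
    Integrable fun y : Rn n => weight N y * heatKernelDeriv t y := by
  simpa [mul_comm] using
    (hasDerivAt_integral_heatKernel_smul (gaussIntegrable_weight (n := n) hN) ht).1

theorem integrable_smul_translation (hk : 0 ≤ k) (f : WeightedSpace n Y κ k) {a : Rn n → ℝ}
    (ha : Continuous a) (hai : Integrable fun y => weight k y * a y) :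
    Integrable fun y => a y • translation hk y f := by
  refine (hai.norm.mul_const ‖f‖).mono'
    (ha.smul (continuous_translation hk f)).aestronglyMeasurable (Eventually.of_forall fun y => ?_)
  rw [norm_smul, norm_mul, Real.norm_of_nonneg (weight_pos k y).le]
  calc ‖a y‖ * ‖translation hk y f‖ ≤ ‖a y‖ * (weight k y * ‖f‖) :=
        mul_le_mul_of_nonneg_left (norm_translation_le hk y f) (norm_nonneg _)
    _ = _ := by ring

theorem gaussIntegrable_translation (hk : 0 ≤ k) (f : WeightedSpace n Y κ k) :
    GaussIntegrable fun y => translation hk y f := by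
  intro c hc
  refine integrable_smul_translation hk f (by fun_prop) ?_
  simpa [mul_comm] using gaussIntegrable_weight (n := n) hk c hc

/-! ### The heat semigroup on `wX` -/

theorem weight_smul_le (hk : 0 ≤ k) {c : ℝ} (hc : 0 ≤ c) (z : Rn n) :
    weight k (c • z) ≤ (1 + c) ^ k * weight k z := by
  unfold weight
  rw [← Real.mul_rpow (by positivity) (one_add_norm_pos z).le]
  refine Real.rpow_le_rpow (one_add_norm_pos _).le ?_ hk
  rw [norm_smul, Real.norm_of_nonneg hc]
  nlinarith [norm_nonneg z]

theorem norm_heatKernel_one_smul_translation_le (hk : 0 ≤ k) (f : WeightedSpace n Y κ k) {c R : ℝ}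
    (hc : 0 ≤ c) (hcR : c ≤ R) (z : Rn n) :
    ‖heatKernel 1 z • translation hk (c • z) f‖ ≤
      (1 + R) ^ k * (weight k z * heatKernel 1 z) * ‖f‖ := by
  rw [norm_smul, Real.norm_of_nonneg (heatKernel_nonneg zero_le_one z)]
  have h1 : weight k (c • z) ≤ (1 + R) ^ k * weight k z :=
    (weight_smul_le hk hc z).trans (mul_le_mul_of_nonneg_right
      (Real.rpow_le_rpow (by positivity) (by linarith) hk) (weight_pos k z).le)
  calc heatKernel 1 z * ‖translation hk (c • z) f‖
      ≤ heatKernel 1 z * (weight k (c • z) * ‖f‖) :=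
        mul_le_mul_of_nonneg_left (norm_translation_le hk _ f) (heatKernel_nonneg zero_le_one z)
    _ ≤ heatKernel 1 z * ((1 + R) ^ k * weight k z * ‖f‖) :=
        mul_le_mul_of_nonneg_left (mul_le_mul_of_nonneg_right h1 (norm_nonneg f))
          (heatKernel_nonneg zero_le_one z)
    _ = _ := by ring

theorem continuous_heatKernel_one_smul_translation (hk : 0 ≤ k) (f : WeightedSpace n Y κ k)
    (c : ℝ) : Continuous fun z : Rn n => heatKernel 1 z • translation hk (c • z) f :=
  (continuous_heatKernel 1).smul
    ((continuous_translation hk f).comp (continuous_const_smul c))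

theorem integrable_heatKernel_one_smul_translation (hk : 0 ≤ k) (f : WeightedSpace n Y κ k)
    {c : ℝ} (hc : 0 ≤ c) : Integrable fun z => heatKernel 1 z • translation hk (c • z) f :=
  (((integrable_weight_mul_heatKernel hk one_pos).const_mul ((1 + c) ^ k)).mul_const ‖f‖).mono'
    (continuous_heatKernel_one_smul_translation hk f c).aestronglyMeasurable
    (Eventually.of_forall fun z => norm_heatKernel_one_smul_translation_le hk f hc le_rfl z)

/-- The heat semigroup `G(t) f = ∫ K₁(z) f(· - √t z) dz` on `wX`, with `K₁` the heat kernel at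
time `1`. In this form the operator at `t = 0` is the identity (as it is, by the convention for
`√t`, for `t < 0`), and no singularity appears there. -/
def heatOp (hk : 0 ≤ k) (t : ℝ) : WeightedSpace n Y κ k →L[ℝ] WeightedSpace n Y κ k :=
  LinearMap.mkContinuous
    { toFun := fun f => ∫ z, heatKernel 1 z • translation hk (√t • z) f
      map_add' := fun f g => by
        simp only [map_add, smul_add]
        exact integral_add (integrable_heatKernel_one_smul_translation hk f (Real.sqrt_nonneg t))
          (integrable_heatKernel_one_smul_translation hk g (Real.sqrt_nonneg t))
      map_smul' := fun c f => by
        simp only [map_smul, RingHom.id_apply, smul_comm _ c]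
        exact integral_smul c _ }
    ((1 + √t) ^ k * ∫ z : Rn n, weight k z * heatKernel 1 z) fun f => by
      refine (norm_integral_le_integral_norm _).trans ?_
      rw [← integral_const_mul, ← integral_mul_const]
      exact integral_mono
        (integrable_heatKernel_one_smul_translation hk f (Real.sqrt_nonneg t)).norm
        (((integrable_weight_mul_heatKernel hk one_pos).const_mul _).mul_const ‖f‖)
        fun z => norm_heatKernel_one_smul_translation_le hk f (Real.sqrt_nonneg t) le_rfl z

theorem heatOp_apply (hk : 0 ≤ k) (t : ℝ) (f : WeightedSpace n Y κ k) :
    heatOp hk t f = ∫ z, heatKernel 1 z • translation hk (√t • z) f := rfl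

theorem norm_heatOp_le (hk : 0 ≤ k) (t : ℝ) :
    ‖(heatOp hk t : WeightedSpace n Y κ k →L[ℝ] _)‖ ≤
      (1 + √t) ^ k * ∫ z : Rn n, weight k z * heatKernel 1 z :=
  LinearMap.mkContinuous_norm_le _ (mul_nonneg (by positivity) (integral_nonneg fun z =>
    mul_nonneg (weight_pos k z).le (heatKernel_nonneg zero_le_one z))) _

theorem eventually_norm_heatOp_le (hk : 0 ≤ k) (t₀ : ℝ) : ∃ C : ℝ, ∀ᶠ t in 𝓝 t₀,
    ‖(heatOp hk t : WeightedSpace n Y κ k →L[ℝ] _)‖ ≤ C := by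
  refine ⟨(1 + √(t₀ + 1)) ^ k * ∫ z : Rn n, weight k z * heatKernel 1 z, ?_⟩
  filter_upwards [eventually_lt_nhds (lt_add_one t₀)] with t ht
  refine (norm_heatOp_le hk t).trans (mul_le_mul_of_nonneg_right ?_ (integral_nonneg fun z =>
    mul_nonneg (weight_pos k z).le (heatKernel_nonneg zero_le_one z)))
  exact Real.rpow_le_rpow (by positivity) (by gcongr) hk

theorem continuous_heatOp (hk : 0 ≤ k) (f : WeightedSpace n Y κ k) :
    Continuous fun t => heatOp hk t f := by
  refine continuous_iff_continuousAt.2 fun t₀ => ?_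
  simp only [heatOp_apply]
  refine continuousAt_of_dominated
    (bound := fun z => (1 + √(t₀ + 1)) ^ k * (weight k z * heatKernel 1 z) * ‖f‖)
    (Eventually.of_forall fun t =>
      (continuous_heatKernel_one_smul_translation hk f _).aestronglyMeasurable) ?_
    (((integrable_weight_mul_heatKernel hk one_pos).const_mul _).mul_const _)
    (Eventually.of_forall fun z => ?_)
  · filter_upwards [eventually_lt_nhds (lt_add_one t₀)] with t ht
    exact Eventually.of_forall fun z => norm_heatKernel_one_smul_translation_le hk f
      (Real.sqrt_nonneg t) (Real.sqrt_le_sqrt ht.le) z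
  · exact (((continuous_translation hk f).comp
      (Real.continuous_sqrt.smul continuous_const)).const_smul _).continuousAt

theorem heatOp_of_pos (hk : 0 ≤ k) {t : ℝ} (ht : 0 < t) (f : WeightedSpace n Y κ k) :
    heatOp hk t f = ∫ y, heatKernel t y • translation hk y f := by
  have hs : 0 < √t := Real.sqrt_pos.2 ht
  have h := Measure.integral_comp_smul (volume : Measure (Rn n))
    (fun y => heatKernel 1 ((√t)⁻¹ • y) • translation hk y f) (√t)
  simp only [smul_smul, inv_mul_cancel₀ hs.ne', one_smul] at h
  rw [heatOp_apply, h, ← integral_smul]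
  refine integral_congr_ae (Eventually.of_forall fun y => ?_)
  simp only [smul_smul]
  congr 1
  have h1 : |(√t ^ Module.finrank ℝ (Rn n))⁻¹| = t ^ (-(n : ℝ) / 2) := by
    rw [abs_of_pos (by positivity), finrank_euclideanSpace, Fintype.card_fin, Real.sqrt_eq_rpow,
      ← Real.rpow_natCast, ← Real.rpow_mul ht.le, ← Real.rpow_neg ht.le]
    congr 1
    ring
  rw [h1, heatKernel, heatKernel, Real.mul_rpow (by positivity) ht.le, norm_smul, norm_inv,
    Real.norm_of_nonneg hs.le, mul_pow, inv_pow, Real.sq_sqrt ht.le, mul_one, mul_one, ← mul_assoc,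
    mul_comm (t ^ _)]
  congr 2
  field_simp

variable [CompleteSpace Y]

/-- A Bochner integral of translates in `wX`, tested against a continuous compactly supported
function. -/
theorem integral_smul_toFun_integral_translation (hk : 0 ≤ k) (f : WeightedSpace n Y κ k)
    {a φ : Rn n → ℝ} (ha : Continuous a) (hai : Integrable fun y => weight k y * a y)
    (hφ : Continuous φ) (hc : HasCompactSupport φ) :
    ∫ x, φ x • (∫ y, a y • translation hk y f).toFun x =
      ∫ y, a y • ∫ x, φ x • f.toFun (x - y) := by
  obtain ⟨l, hl⟩ := WeightedSpace.exists_pairing (Y := Y) κ k hφ hc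
  rw [← hl, ← l.integral_comp_comm (integrable_smul_translation hk f ha hai)]
  refine integral_congr_ae (Eventually.of_forall fun y => ?_)
  change l (a y • translation hk y f) = _
  rw [map_smul, hl]
  congr 1
  refine integral_congr_ae ?_
  filter_upwards [toFun_translation hk y f] with x hx
  rw [hx]

/-- The Bochner integral of translates in `wX` is represented by the pointwise Gauss–Poisson
integral. -/
theorem toFun_integral_heatKernel_translation (hk : 0 ≤ k) (f : WeightedSpace n Y κ k) {t : ℝ}
    (ht : 0 < t) :
    (∫ y, heatKernel t y • translation hk y f).toFun =ᵐ[volume] gaussPoisson t f.toFun := by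
  have hN := add_natCast_add_one_nonneg n hk
  have hcont : Continuous (gaussPoisson t f.toFun) := by
    have := (contDiffOn_gaussPoisson (f.gaussIntegrable_toFun hk)).continuousOn
    exact this.comp_continuous (f := fun x : Rn n => (t, x)) (by fun_prop) fun x => ⟨ht, trivial⟩
  refine ae_eq_of_integral_contDiff_smul_eq
    (locallyIntegrable_of_weight (WeightedSpace.integrable_weight_smul _))
    hcont.locallyIntegrable fun φ hφ hc => ?_
  rw [integral_smul_toFun_integral_translation hk f (continuous_heatKernel t)
    (integrable_weight_mul_heatKernel hk ht) hφ.continuous hc,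
    integral_smul_integral_convolve hN f.integrable_weight_smul hφ.continuous hc
      (continuous_heatKernel t) (integrable_weight_mul_heatKernel hN ht)]
  simp only [gaussPoisson_eq_integral]

/-- The Laplacian can be moved onto the heat kernel. -/
theorem hasLaplacian_integral_heatKernel (hk : 0 ≤ k) (f : WeightedSpace n Y κ k) {t : ℝ}
    (ht : 0 < t) : HasLaplacian (∫ y, heatKernel t y • translation hk y f)
      (∫ y, heatKernelDeriv t y • translation hk y f) := by
  intro φ hφ hc
  have hN := add_natCast_add_one_nonneg n hk
  have hφ' := (contDiff_laplace hφ).continuous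
  have hc' := hasCompactSupport_laplace hφ hc
  rw [integral_smul_toFun_integral_translation hk f (continuous_heatKernel t)
    (integrable_weight_mul_heatKernel hk ht) hφ' hc',
    integral_smul_toFun_integral_translation hk f (continuous_heatKernelDeriv t)
      (integrable_weight_mul_heatKernelDeriv hk ht) hφ.continuous hc,
    integral_smul_integral_translate hN f.integrable_weight_smul hφ' hc'
      (continuous_heatKernel t) (integrable_weight_mul_heatKernel hN ht),
    integral_smul_integral_translate hN f.integrable_weight_smul hφ.continuous hc
      (continuous_heatKernelDeriv t) (integrable_weight_mul_heatKernelDeriv hN ht)]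
  simp only [integral_laplace_mul_heatKernel hφ hc]

/-- On the domain of the Laplacian, the Laplacian commutes with the heat semigroup. -/
theorem HasLaplacian.integral_heatKernelDeriv (hk : 0 ≤ k) {f g : WeightedSpace n Y κ k}
    (h : HasLaplacian f g) {t : ℝ} (ht : 0 < t) :
    ∫ y, heatKernelDeriv t y • WeightedHeat.translation hk y f =
      ∫ y, heatKernel t y • WeightedHeat.translation hk y g := by
  refine WeightedSpace.ext_test fun φ hφ hc => ?_
  rw [← hasLaplacian_integral_heatKernel hk f ht φ hφ hc]
  obtain ⟨l, hl⟩ := WeightedSpace.exists_pairing (Y := Y) κ k hφ.continuous hc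
  obtain ⟨m, hm⟩ := WeightedSpace.exists_pairing (Y := Y) κ k (contDiff_laplace hφ).continuous
    (hasCompactSupport_laplace hφ hc)
  have hi := fun f : WeightedSpace n Y κ k => integrable_smul_translation hk f
    (continuous_heatKernel t) (integrable_weight_mul_heatKernel hk ht)
  rw [← hl, ← hm, ← l.integral_comp_comm (hi g), ← m.integral_comp_comm (hi f)]
  refine integral_congr_ae (Eventually.of_forall fun y => ?_)
  change m (heatKernel t y • WeightedHeat.translation hk y f) =
    l (heatKernel t y • WeightedHeat.translation hk y g)
  rw [map_smul, map_smul, hl, hm, h.translation hk y φ hφ hc]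

theorem integral_heatKernel_one : ∫ z : Rn n, heatKernel 1 z = 1 := by
  have h := GaussianFourier.integral_rexp_neg_mul_sq_norm (V := Rn n) (b := 1 / 4) (by norm_num)
  have h2 : ∀ z : Rn n, heatKernel 1 z =
      (4 * Real.pi) ^ (-(n : ℝ) / 2) * Real.exp (-(1 / 4) * ‖z‖ ^ 2) := fun z => by
    simp only [heatKernel, mul_one]
    congr 2
    ring
  simp_rw [h2]
  rw [integral_const_mul, h, finrank_euclideanSpace, Fintype.card_fin, div_div_eq_mul_div, div_one,
    mul_comm Real.pi, ← Real.rpow_add (by positivity)]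
  ring_nf
  simp

theorem heatOp_zero (hk : 0 ≤ k) (f : WeightedSpace n Y κ k) : heatOp hk 0 f = f := by
  simp only [heatOp_apply, Real.sqrt_zero, zero_smul, translation_zero]
  rw [integral_smul_const, integral_heatKernel_one, one_smul]

theorem hasDerivAt_heatOp (hk : 0 ≤ k) {t : ℝ} (ht : 0 < t) (f : WeightedSpace n Y κ k) :
    HasDerivAt (fun t => heatOp hk t f) (∫ y, heatKernelDeriv t y • translation hk y f) t := by
  refine (hasDerivAt_integral_heatKernel_smul (gaussIntegrable_translation hk f)
    ht).2.congr_of_eventuallyEq ?_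
  filter_upwards [eventually_gt_nhds ht] with s hs
  exact heatOp_of_pos hk hs f

theorem hasLaplacian_heatOp (hk : 0 ≤ k) {t : ℝ} (ht : 0 < t) (f : WeightedSpace n Y κ k) :
    HasLaplacian (heatOp hk t f) (∫ y, heatKernelDeriv t y • translation hk y f) := by
  rw [heatOp_of_pos hk ht]
  exact hasLaplacian_integral_heatKernel hk f ht

theorem isGaussOrbit_heatOp (hk : 0 ≤ k) (f : WeightedSpace n Y κ k) :
    IsGaussOrbit (fun t => heatOp hk t f) f := by
  refine ⟨heatOp_zero hk f, fun t ht =>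
    ⟨fun x => (f.gaussIntegrable_toFun hk).integrable_gaussIntegrand ht x, ?_⟩⟩
  change (heatOp hk t f).toFun =ᵐ[volume] _
  rw [heatOp_of_pos hk ht]
  exact toFun_integral_heatKernel_translation hk f ht

theorem isC1Solution_heatOp (hk : 0 ≤ k) (f : WeightedSpace n Y κ k) :
    IsC1Solution (fun t => heatOp hk t f) := by
  refine ⟨?_, fun t ht => ?_⟩
  · refine ((contDiffOn_integral_heatKernel_smul (gaussIntegrable_translation hk f)).of_le
      (by simp)).congr fun t ht => heatOp_of_pos hk ht f
  · rw [(hasDerivAt_heatOp hk ht f).deriv]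
    exact hasLaplacian_heatOp hk ht f

/-! ### Mild solutions -/

/-- A continuous function into `wX` which solves the heat equation in the sense of distributions
in space, pointwise in time, is a mild solution. -/
theorem isMildSolution_of_hasDerivAt {u : ℝ → WeightedSpace n Y κ k}
    (hu : ContinuousOn u (Ici 0))
    (h : ∀ φ : Rn n → ℝ, ContDiff ℝ ∞ φ → HasCompactSupport φ → ∀ t, 0 < t →
      HasDerivAt (fun s => ∫ x, φ x • (u s).toFun x) (∫ x, laplace φ x • (u t).toFun x) t) :
    IsMildSolution u := by
  refine ⟨hu, fun t ht φ hφ hc => ?_⟩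
  obtain ⟨l, hl⟩ := WeightedSpace.exists_pairing (Y := Y) κ k hφ.continuous hc
  obtain ⟨m, hm⟩ := WeightedSpace.exists_pairing (Y := Y) κ k (contDiff_laplace hφ).continuous
    (hasCompactSupport_laplace hφ hc)
  have h' := h φ hφ hc
  simp only [← hl, ← hm] at h' ⊢
  have hut : ContinuousOn u (Icc 0 t) := hu.mono Icc_subset_Ici_self
  have hui : IntervalIntegrable u volume 0 t := by
    refine ContinuousOn.intervalIntegrable ?_
    rwa [uIcc_of_le ht]
  rw [← m.intervalIntegral_comp_comm hui, map_sub]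
  refine intervalIntegral.integral_eq_sub_of_hasDerivAt_of_le ht
    (l.continuous.comp_continuousOn hut) (fun s hs => h' s hs.1) ?_
  refine ContinuousOn.intervalIntegrable ?_
  rw [uIcc_of_le ht]
  exact m.continuous.comp_continuousOn hut

theorem hasDerivAt_integral_smul_heatOp (hk : 0 ≤ k) (f : WeightedSpace n Y κ k) {φ : Rn n → ℝ}
    (hφ : ContDiff ℝ ∞ φ) (hc : HasCompactSupport φ) {t : ℝ} (ht : 0 < t) :
    HasDerivAt (fun s => ∫ x, φ x • (heatOp hk s f).toFun x)
      (∫ x, laplace φ x • (heatOp hk t f).toFun x) t := by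
  obtain ⟨l, hl⟩ := WeightedSpace.exists_pairing (Y := Y) κ k hφ.continuous hc
  rw [hasLaplacian_heatOp hk ht f φ hφ hc]
  simp only [← hl]
  exact l.hasFDerivAt.comp_hasDerivAt t (hasDerivAt_heatOp hk ht f)

theorem isMildSolution_heatOp (hk : 0 ≤ k) (f : WeightedSpace n Y κ k) :
    IsMildSolution (fun t => heatOp hk t f) :=
  isMildSolution_of_hasDerivAt (continuous_heatOp hk f).continuousOn
    fun _ hφ hc _ ht => hasDerivAt_integral_smul_heatOp hk f hφ hc ht

end Semigroup

/-! ### Uniqueness of mild solutions -/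

section ProductRule

variable {E F : Type*} [NormedAddCommGroup E] [NormedSpace ℝ E] [NormedAddCommGroup F]
  [NormedSpace ℝ F]

/-- Joint continuity of evaluation for strongly convergent, locally bounded operators. -/
theorem tendsto_clm_apply_of_strong {ι : Type*} {l : Filter ι} {A : ι → E →L[ℝ] F} {x : ι → E}
    {x₀ : E} {y : F} (hA : Tendsto (fun r => A r x₀) l (𝓝 y)) (hb : ∃ C : ℝ, ∀ᶠ r in l, ‖A r‖ ≤ C)
    (hx : Tendsto x l (𝓝 x₀)) : Tendsto (fun r => A r (x r)) l (𝓝 y) := by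
  obtain ⟨C, hC⟩ := hb
  have h1 : Tendsto (fun r => A r (x r - x₀)) l (𝓝 0) := by
    refine squeeze_zero_norm' (a := fun r => C * ‖x r - x₀‖) ?_ ?_
    · filter_upwards [hC] with r hr
      exact (A r).le_of_opNorm_le hr _
    · simpa using (hx.sub_const x₀).norm.const_mul C
  simpa using h1.add hA

/-- Product rule for a family of operators that is only strongly differentiable. -/
theorem HasDerivAt.clm_apply_of_strong {A : ℝ → E →L[ℝ] F} {x : ℝ → E} {s : ℝ} {D : F} {x' : E}
    (hA : HasDerivAt (fun r => A r (x s)) D s) (hAc : ContinuousAt (fun r => A r x') s)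
    (hb : ∃ C : ℝ, ∀ᶠ r in 𝓝 s, ‖A r‖ ≤ C) (hx : HasDerivAt x x' s) :
    HasDerivAt (fun r => A r (x r)) (D + A s x') s := by
  obtain ⟨C, hC⟩ := hb
  rw [hasDerivAt_iff_isLittleO] at hA hx ⊢
  have h2 : (fun r => (r - s) • (A r x' - A s x')) =o[𝓝 s] fun r => r - s := by
    have h3 : (fun r => A r x' - A s x') =o[𝓝 s] fun _ => (1 : ℝ) := by
      rw [Asymptotics.isLittleO_one_iff]
      simpa using hAc.tendsto.sub_const (A s x')
    simpa using (Asymptotics.isBigO_refl (fun r => r - s) (𝓝 s)).smul_isLittleO h3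
  have h3 : (fun r => A r (x r - x s - (r - s) • x')) =o[𝓝 s] fun r => r - s := by
    refine Asymptotics.IsBigO.trans_isLittleO (Asymptotics.IsBigO.of_bound C ?_) hx
    filter_upwards [hC] with r hr
    exact (A r).le_of_opNorm_le hr _
  refine ((hA.add h2).add h3).congr_left fun r => ?_
  simp only [map_sub, map_smul, smul_add, smul_sub]
  abel

end ProductRule

section Uniqueness

variable {n : ℕ} {Y : Type*} [NormedAddCommGroup Y] [NormedSpace ℂ Y] [CompleteSpace Y]
  {κ : SpaceKind} {k : ℝ}

/-- Mild solutions with zero initial value vanish: for `U(s) = ∫₀ˢ u`, the function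
`s ↦ G(t - s) U(s)` is constant on `[0, t]`. -/
theorem eq_zero_of_hasLaplacian_integral (hk : 0 ≤ k) {u : ℝ → WeightedSpace n Y κ k}
    (hu : Continuous u) (h : ∀ t, 0 ≤ t → HasLaplacian (∫ s in (0 : ℝ)..t, u s) (u t)) {t : ℝ}
    (ht : 0 < t) : u t = 0 := by
  set U : ℝ → WeightedSpace n Y κ k := fun t => ∫ s in (0 : ℝ)..t, u s with hU
  have hU' : ∀ t, HasDerivAt U (u t) t := fun t => (hu.integral_hasStrictDerivAt 0 t).hasDerivAt
  have hb : ∀ t s : ℝ, ∃ C : ℝ, ∀ᶠ r in 𝓝 s,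
      ‖(heatOp hk (t - r) : WeightedSpace n Y κ k →L[ℝ] _)‖ ≤ C := fun t s => by
    obtain ⟨C, hC⟩ := eventually_norm_heatOp_le (n := n) (Y := Y) (κ := κ) hk (t - s)
    exact ⟨C, ((continuous_sub_left t).tendsto s).eventually hC⟩
  have hc : ∀ (t : ℝ) (v : WeightedSpace n Y κ k), Continuous fun r => heatOp hk (t - r) v :=
    fun t v => (continuous_heatOp hk v).comp (continuous_sub_left t)
  have hU0 : ∀ t, 0 < t → U t = 0 := by
    intro t ht
    have hconst := constant_of_has_deriv_right_zero (f := fun s => heatOp hk (t - s) (U s))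
      (a := 0) (b := t) (fun s _ => ContinuousAt.continuousWithinAt
        (tendsto_clm_apply_of_strong ((hc t (U s)).tendsto s) (hb t s) (hU' s).continuousAt))
      (fun s hs => by
        have hts : 0 < t - s := sub_pos.2 hs.2
        have h1 : HasDerivAt (fun r => heatOp hk (t - r) (U s)) (-(heatOp hk (t - s) (u s))) s := by
          have := (hasDerivAt_heatOp hk hts (U s)).scomp s ((hasDerivAt_id s).const_sub t)
          rw [(h s hs.1).integral_heatKernelDeriv hk hts, ← heatOp_of_pos hk hts, neg_one_smul]
            at this
          exact this
        have h2 := HasDerivAt.clm_apply_of_strong h1 (hc t (u s)).continuousAt (hb t s) (hU' s)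
        rw [neg_add_cancel] at h2
        exact h2.hasDerivWithinAt)
    have := hconst t (right_mem_Icc.2 ht.le)
    simpa [heatOp_zero, hU] using this
  refine (hU' t).unique ?_
  refine (hasDerivAt_const t (0 : WeightedSpace n Y κ k)).congr_of_eventuallyEq ?_
  filter_upwards [eventually_gt_nhds ht] with s hs
  exact hU0 s hs

theorem IsMildSolution.eq_heatOp (hk : 0 ≤ k) {u : ℝ → WeightedSpace n Y κ k}
    (hu : IsMildSolution u) {t : ℝ} (ht : 0 ≤ t) : u t = heatOp hk t (u 0) := by
  have hv := isMildSolution_heatOp hk (u 0)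
  -- the difference is extended continuously to negative times
  set d : ℝ → WeightedSpace n Y κ k := fun s => u (max s 0) - heatOp hk (max s 0) (u 0) with hd
  have hdc : Continuous d := by
    have hm : Continuous fun s : ℝ => max s 0 := by fun_prop
    exact (hu.1.comp_continuous hm fun s => le_max_right s 0).sub
      (hv.1.comp_continuous hm fun s => le_max_right s 0)
  have hint : ∀ w : ℝ → WeightedSpace n Y κ k, ContinuousOn w (Ici 0) → ∀ t, 0 ≤ t →
      IntervalIntegrable w volume 0 t := fun w hw t ht =>
    ContinuousOn.intervalIntegrable (hw.mono (by rw [uIcc_of_le ht]; exact Icc_subset_Ici_self))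
  rcases ht.eq_or_lt with rfl | ht
  · rw [heatOp_zero]
  have := eq_zero_of_hasLaplacian_integral hk hdc (fun t ht => ?_) ht
  · rw [hd] at this
    simp only [max_eq_left ht.le] at this
    exact sub_eq_zero.1 this
  · have h1 := (hu.2 t ht).sub (hv.2 t ht)
    have h2 : d t = u t - u 0 - (heatOp hk t (u 0) - heatOp hk 0 (u 0)) := by
      simp [hd, max_eq_left ht, heatOp_zero]
    rw [h2]
    convert! h1 using 1
    rw [← intervalIntegral.integral_sub (hint u hu.1 t ht) (hint _ hv.1 t ht)]
    refine intervalIntegral.integral_congr fun s hs => ?_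
    rw [uIcc_of_le ht] at hs
    simp [hd, max_eq_left hs.1]

end Uniqueness

/-! ### Classical and distributional solutions -/

section Classical

variable {n : ℕ} {Y : Type*} [NormedAddCommGroup Y] [NormedSpace ℂ Y]

theorem isOpen_openHalfSpace (n : ℕ) : IsOpen (openHalfSpace n) := isOpen_Ioi.prod isOpen_univ

theorem continuous_of_continuousOn_openHalfSpace {F : Type*} [TopologicalSpace F]
    {V : ℝ × Rn n → F} (hV : ContinuousOn V (openHalfSpace n)) {t : ℝ} (ht : 0 < t) :
    Continuous fun x => V (t, x) :=
  hV.comp_continuous (f := fun x : Rn n => (t, x)) (by fun_prop) fun x => ⟨ht, trivial⟩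

/-- Differentiation in time under an integral against a test function. -/
theorem hasDerivAt_integral_smul {v : ℝ → Rn n → Y}
    (hv : ContinuousOn (fun z : ℝ × Rn n => v z.1 z.2) (openHalfSpace n))
    (hd : ∀ t, 0 < t → ∀ x, DifferentiableAt ℝ (fun s => v s x) t)
    (hv' : ContinuousOn (fun z : ℝ × Rn n => deriv (fun s => v s z.2) z.1) (openHalfSpace n))
    {φ : Rn n → ℝ} (hφ : Continuous φ) (hc : HasCompactSupport φ) {t : ℝ} (ht : 0 < t) :
    HasDerivAt (fun s => ∫ x, φ x • v s x) (∫ x, φ x • deriv (fun s => v s x) t) t := by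
  have hK : IsCompact (Icc (t / 2) (2 * t) ×ˢ tsupport φ) := isCompact_Icc.prod hc
  obtain ⟨B, hB⟩ := hK.exists_bound_of_continuousOn (hv'.mono fun z hz =>
    ⟨lt_of_lt_of_le (half_pos ht) hz.1.1, trivial⟩)
  have hvt : ∀ s, 0 < s → Continuous (v s) := fun s hs =>
    continuous_of_continuousOn_openHalfSpace hv hs
  refine (hasDerivAt_integral_of_dominated_loc_of_deriv_le
    (F' := fun s x => φ x • deriv (fun s => v s x) s) (bound := fun x => ‖φ x‖ * B)
    (Icc_mem_nhds (half_lt_self ht) (by linarith : t < 2 * t)) ?_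
    (integrable_smul_of_compactSupport hφ hc (hvt t ht))
    (hφ.smul (continuous_of_continuousOn_openHalfSpace hv' ht)).aestronglyMeasurable
    (Eventually.of_forall fun x s hs => ?_)
    ((hφ.norm.integrable_of_hasCompactSupport hc.norm).mul_const B)
    (Eventually.of_forall fun x s hs => ?_)).2
  · filter_upwards [eventually_gt_nhds ht] with s hs
    exact (hφ.smul (hvt s hs)).aestronglyMeasurable
  · by_cases hx : x ∈ tsupport φ
    · rw [norm_smul]
      exact mul_le_mul_of_nonneg_left (hB (s, x) ⟨hs, hx⟩) (norm_nonneg _)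
    · simp [image_eq_zero_of_notMem_tsupport hx]
  · exact (hd s ((half_pos ht).trans_le hs.1) x).hasDerivAt.const_smul (φ x)

theorem IsClassicalSolution.hasDerivAt_integral_smul {v : ℝ → Rn n → Y}
    (hv : IsClassicalSolution v) {φ : Rn n → ℝ} (hφ : ContDiff ℝ ∞ φ) (hc : HasCompactSupport φ)
    {t : ℝ} (ht : 0 < t) :
    HasDerivAt (fun s => ∫ x, φ x • v s x) (∫ x, laplace φ x • v t x) t := by
  have h := WeightedHeat.hasDerivAt_integral_smul hv.continuousOn hv.differentiableAt_time
    hv.continuousOn_time hφ.continuous hc ht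
  simp only [hv.equation t ht] at h
  rwa [integral_laplace_smul hφ hc (continuous_of_continuousOn_openHalfSpace hv.continuousOn ht)
    (fun j x => hv.differentiableAt_space t ht x j)
    (fun j => continuous_of_continuousOn_openHalfSpace (hv.continuousOn_space j) ht)
    (fun j x => hv.differentiableAt_space₂ t ht x j)
    (fun j => continuous_of_continuousOn_openHalfSpace (hv.continuousOn_space₂ j) ht)]

section Smooth

variable {F : Type*} [NormedAddCommGroup F] [NormedSpace ℝ F] {V : ℝ × Rn n → F}

theorem differentiableAt_of_contDiffOn (hV : ContDiffOn ℝ ∞ V (openHalfSpace n)) {t : ℝ}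
    (ht : 0 < t) (x : Rn n) : DifferentiableAt ℝ V (t, x) :=
  (hV.differentiableOn (by simp)).differentiableAt
    ((isOpen_openHalfSpace n).mem_nhds ⟨ht, trivial⟩)

theorem contDiffOn_fderiv_apply (hV : ContDiffOn ℝ ∞ V (openHalfSpace n)) (w : ℝ × Rn n) :
    ContDiffOn ℝ ∞ (fun z => fderiv ℝ V z w) (openHalfSpace n) :=
  (hV.fderiv_of_isOpen (isOpen_openHalfSpace n) (by simp)).clm_apply contDiffOn_const

theorem hasDerivAt_time_of_contDiffOn (hV : ContDiffOn ℝ ∞ V (openHalfSpace n)) {t : ℝ}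
    (ht : 0 < t) (x : Rn n) :
    HasDerivAt (fun s => V (s, x)) (fderiv ℝ V (t, x) (1, 0)) t :=
  (differentiableAt_of_contDiffOn hV ht x).hasFDerivAt.comp_hasDerivAt t
    ((hasDerivAt_id t).prodMk (hasDerivAt_const t x))

theorem hasLineDerivAt_of_contDiffOn (hV : ContDiffOn ℝ ∞ V (openHalfSpace n)) {t : ℝ}
    (ht : 0 < t) (x w : Rn n) :
    HasLineDerivAt ℝ (fun x => V (t, x)) (fderiv ℝ V (t, x) (0, w)) x w := by
  have h := ((differentiableAt_of_contDiffOn hV ht x).hasFDerivAt.comp x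
    (hasFDerivAt_prodMk_right t x)).hasLineDerivAt w
  exact h

theorem partialDeriv_of_contDiffOn (hV : ContDiffOn ℝ ∞ V (openHalfSpace n)) {t : ℝ}
    (ht : 0 < t) (j : Fin n) : partialDeriv j (fun x => V (t, x)) =
      fun x => fderiv ℝ V (t, x) (0, EuclideanSpace.single j 1) :=
  funext fun x => (hasLineDerivAt_of_contDiffOn hV ht x _).lineDeriv

end Smooth

/-- A smooth function on `M` which solves the heat equation in the sense of distributions in
space is a classical solution. -/
theorem isClassicalSolution_of_contDiffOn [CompleteSpace Y] {v : ℝ → Rn n → Y}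
    (hv : ContDiffOn ℝ ∞ (fun z : ℝ × Rn n => v z.1 z.2) (openHalfSpace n))
    (h : ∀ φ : Rn n → ℝ, ContDiff ℝ ∞ φ → HasCompactSupport φ → ∀ t, 0 < t →
      HasDerivAt (fun s => ∫ x, φ x • v s x) (∫ x, laplace φ x • v t x) t) :
    IsClassicalSolution v := by
  set e : Fin n → Rn n := fun j => EuclideanSpace.single j 1 with he
  set V : ℝ × Rn n → Y := fun z => v z.1 z.2 with hV
  have hW := fun j => contDiffOn_fderiv_apply hv (0, e j)
  have hp : ∀ t, 0 < t → ∀ j, partialDeriv j (v t) = fun x => fderiv ℝ V (t, x) (0, e j) :=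
    fun t ht j => partialDeriv_of_contDiffOn hv ht j
  have hp₂ : ∀ t, 0 < t → ∀ j, partialDeriv j (partialDeriv j (v t)) =
      fun x => fderiv ℝ (fun z => fderiv ℝ V z (0, e j)) (t, x) (0, e j) := fun t ht j => by
    rw [hp t ht j]
    exact partialDeriv_of_contDiffOn (hW j) ht j
  have hdt : ∀ t, 0 < t → ∀ x, HasDerivAt (fun s => v s x) (fderiv ℝ V (t, x) (1, 0)) t :=
    fun t ht x => hasDerivAt_time_of_contDiffOn hv ht x
  have hd : ∀ t, 0 < t → ∀ x, ∀ j : Fin n,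
      LineDifferentiableAt ℝ (v t) x (EuclideanSpace.single j 1) := fun t ht x j =>
    (hasLineDerivAt_of_contDiffOn hv ht x (e j)).lineDifferentiableAt
  have hd₂ : ∀ t, 0 < t → ∀ x, ∀ j : Fin n,
      LineDifferentiableAt ℝ (partialDeriv j (v t)) x (EuclideanSpace.single j 1) :=
    fun t ht x j => by
      rw [hp t ht j]
      exact (hasLineDerivAt_of_contDiffOn (hW j) ht x (e j)).lineDifferentiableAt
  have hct : ContinuousOn (fun z : ℝ × Rn n => deriv (fun s => v s z.2) z.1)
      (openHalfSpace n) :=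
    (contDiffOn_fderiv_apply hv (1, 0)).continuousOn.congr fun z hz => (hdt z.1 hz.1 z.2).deriv
  have hcs : ∀ j : Fin n, ContinuousOn (fun z : ℝ × Rn n => partialDeriv j (v z.1) z.2)
      (openHalfSpace n) := fun j =>
    (hW j).continuousOn.congr fun z hz => congrFun (hp z.1 hz.1 j) z.2
  have hcs₂ : ∀ j : Fin n, ContinuousOn
      (fun z : ℝ × Rn n => partialDeriv j (partialDeriv j (v z.1)) z.2) (openHalfSpace n) :=
    fun j => (contDiffOn_fderiv_apply (hW j) (0, e j)).continuousOn.congr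
      fun z hz => congrFun (hp₂ z.1 hz.1 j) z.2
  have hdiff : ∀ t, 0 < t → ∀ x, DifferentiableAt ℝ (fun s => v s x) t :=
    fun t ht x => (hdt t ht x).differentiableAt
  refine ⟨hv.continuousOn, hdiff, hct, hd, hcs, hd₂, hcs₂, fun t ht x => ?_⟩
  have hc1 : Continuous fun x => deriv (fun s => v s x) t :=
    continuous_of_continuousOn_openHalfSpace hct ht
  have hc2 : Continuous (laplace (v t)) :=
    continuous_finsetSum _ fun j _ => continuous_of_continuousOn_openHalfSpace (hcs₂ j) ht
  refine congrFun ((hc1.ae_eq_iff_eq volume hc2).1 (ae_eq_of_integral_contDiff_smul_eq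
    hc1.locallyIntegrable hc2.locallyIntegrable fun φ hφ hc => ?_)) x
  rw [← integral_laplace_smul hφ hc (continuous_of_continuousOn_openHalfSpace hv.continuousOn ht)
    (fun j x => hd t ht x j)
    (fun j => continuous_of_continuousOn_openHalfSpace (hcs j) ht) (fun j x => hd₂ t ht x j)
    (fun j => continuous_of_continuousOn_openHalfSpace (hcs₂ j) ht)]
  exact (hasDerivAt_integral_smul hv.continuousOn hdiff hct hφ.continuous hc ht).unique
    (h φ hφ hc t ht)

theorem isClassicalSolution_gaussPoisson [CompleteSpace Y] {κ : SpaceKind} {k : ℝ} (hk : 0 ≤ k)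
    (f : WeightedSpace n Y κ k) :
    IsClassicalSolution fun t x => gaussPoisson t f.toFun x := by
  refine isClassicalSolution_of_contDiffOn (contDiffOn_gaussPoisson (f.gaussIntegrable_toFun hk))
    fun φ hφ hc t ht => ?_
  have key : ∀ ψ : Rn n → ℝ, ∀ s, 0 < s → ∫ x, ψ x • gaussPoisson s f.toFun x =
      ∫ x, ψ x • (heatOp hk s f).toFun x := fun ψ s hs => by
    refine integral_congr_ae ?_
    filter_upwards [((isGaussOrbit_heatOp hk f).2 s hs).2] with x hx
    rw [← hx]
  rw [key _ t ht]
  refine (hasDerivAt_integral_smul_heatOp hk f hφ hc ht).congr_of_eventuallyEq ?_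
  filter_upwards [eventually_gt_nhds ht] with s hs
  exact key φ s hs

/-! ### Classical solutions with values in `wX` -/

theorem gaussPoisson_congr_ae {f g : Rn n → Y} (h : f =ᵐ[volume] g) (t : ℝ) :
    gaussPoisson t f = gaussPoisson t g := by
  funext x
  rw [gaussPoisson_eq_integral, gaussPoisson_eq_integral]
  refine integral_congr_ae ?_
  filter_upwards [(quasiMeasurePreserving_sub_left volume x).ae_eq_comp h] with y hy
  exact congrArg (heatKernel t y • ·) hy

theorem norm_eq_integral_norm_weight_smul {k : ℝ}
    (f : WeightedSpace n Y (.lp 1 le_rfl ENNReal.one_ne_top) k) :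
    ‖f‖ = ∫ x, ‖weight (-k) x • f.toFun x‖ := by
  refine (L1.norm_eq_integral_norm (show Lp Y 1 (volume : Measure (Rn n)) from f)).trans ?_
  refine integral_congr_ae (Eventually.of_forall fun x => ?_)
  simp only [WeightedSpace.toFun, smul_smul, weight_mul_weight]
  simp [weight, BaseSpace.toFun]

theorem exists_toFun_ae_eq {k : ℝ} {h : Rn n → Y}
    (hi : Integrable fun x => weight (-k) x • h x) :
    ∃ f : WeightedSpace n Y (.lp 1 le_rfl ENNReal.one_ne_top) k, f.toFun =ᵐ[volume] h := by
  refine ⟨hi.toL1 _, ?_⟩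
  filter_upwards [hi.coeFn_toL1] with x hx
  have : (hi.toL1 fun x => weight (-k) x • h x) x = weight (-k) x • h x := hx
  refine (congrArg (weight k x • ·) this).trans ?_
  simp only [smul_smul, weight_mul_weight]
  simp [weight]

variable {κ : SpaceKind} {k : ℝ}

theorem WeightedSpace.toFun_sub (f g : WeightedSpace n Y κ k) :
    (f - g).toFun =ᵐ[volume] fun x => f.toFun x - g.toFun x := by
  filter_upwards [WeightedSpace.toFun_add (f - g) g] with x hx
  rw [sub_add_cancel] at hx
  rw [hx, add_sub_cancel_right]

/-- A continuous function `v` on `M`, locally bounded as a function of time with values in `wX`,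
is continuous in time as a function with values in a weighted `L¹` space of larger weight:
continuity is locally uniform in space, and the tails are small by the additional decay. -/
theorem continuousOn_weightedL1 (hk : 0 ≤ k) {v : ℝ → Rn n → Y} {u : ℝ → WeightedSpace n Y κ k}
    (hv : ContinuousOn (fun z : ℝ × Rn n => v z.1 z.2) (openHalfSpace n))
    (huv : ∀ t, 0 < t → (u t).toFun =ᵐ[volume] v t)
    (hb : ∀ a b : ℝ, 0 < a → a ≤ b → Bornology.IsBounded (u '' Icc a b))
    {w : ℝ → WeightedSpace n Y (.lp 1 le_rfl ENNReal.one_ne_top) (k + n + 1 + 1)}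
    (hw : ∀ t, 0 < t → (w t).toFun =ᵐ[volume] v t) : ContinuousOn w (Ioi 0) := by
  intro t₀ ht₀
  have ht₀' : (0 : ℝ) < t₀ := ht₀
  obtain ⟨C, hC⟩ := WeightedSpace.exists_integral_bound n Y κ k
  obtain ⟨B, hB⟩ := (hb (t₀ / 2) (2 * t₀) (half_pos ht₀') (by linarith)).exists_norm_le
  have hut : ∀ t ∈ Icc (t₀ / 2) (2 * t₀), ‖u t‖ ≤ B := fun t ht => hB _ (mem_image_of_mem u ht)
  have ht₀m : t₀ ∈ Icc (t₀ / 2) (2 * t₀) := ⟨by linarith, by linarith⟩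
  have hB0 : 0 ≤ B := (norm_nonneg _).trans (hut t₀ ht₀m)
  refine ContinuousAt.continuousWithinAt (Metric.tendsto_nhds.2 fun ε hε => ?_)
  -- `D` bounds the norms of the increments in the space with exponent `k + n + 1`; outside the
  -- ball of radius `R` the additional factor is at most `1 / (1 + R)`, and `D / (1 + R) ≤ ε / 2`
  set D : ℝ := |C| * (2 * B) with hD
  have hD0 : 0 ≤ D := by positivity
  set R : ℝ := 2 * D / ε with hR
  have hR0 : 0 ≤ R := by positivity
  -- a continuous cutoff, equal to one on the ball of radius `R`
  set χ : Rn n → ℝ := fun x => max 0 (min 1 (R + 1 - ‖x‖)) with hχ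
  have hχc : Continuous χ := by fun_prop
  have hχ0 : ∀ x, 0 ≤ χ x := fun x => le_max_left _ _
  have hχ1 : ∀ x, ‖x‖ ≤ R → χ x = 1 := fun x hx => by
    simp only [hχ]
    rw [min_eq_left (by linarith), max_eq_right zero_le_one]
  have hχs : ∀ x, x ∉ Metric.closedBall (0 : Rn n) (R + 1) → χ x = 0 := fun x hx => by
    rw [mem_closedBall_zero_iff, not_le] at hx
    exact max_eq_left ((min_le_right _ _).trans (by linarith))
  have hχcs : HasCompactSupport χ :=
    HasCompactSupport.intro (isCompact_closedBall _ _) hχs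
  have hvt : ∀ s, 0 < s → Continuous (v s) := fun s hs =>
    continuous_of_continuousOn_openHalfSpace hv hs
  have hI : ContinuousOn (fun t => ∫ x, χ x * ‖v t x - v t₀ x‖) (Ioi 0) := by
    refine continuousOn_integral_of_compact_support
      (isCompact_closedBall (0 : Rn n) (R + 1)) ?_ fun t x _ hx => by simp [hχs x hx]
    exact (hχc.comp continuous_snd).continuousOn.mul
      (hv.sub ((hvt t₀ ht₀').comp continuous_snd).continuousOn).norm
  have hI0 : ∀ᶠ t in 𝓝 t₀, ∫ x, χ x * ‖v t x - v t₀ x‖ < ε / 2 := by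
    refine (hI.continuousAt (Ioi_mem_nhds ht₀')).eventually_lt continuousAt_const ?_
    simpa using half_pos hε
  filter_upwards [hI0, Icc_mem_nhds (by linarith : t₀ / 2 < t₀) (by linarith : t₀ < 2 * t₀)]
    with t htI ht
  have ht0 : 0 < t := (half_pos ht₀').trans_le ht.1
  have hae : (u t - u t₀).toFun =ᵐ[volume] fun x => v t x - v t₀ x := by
    filter_upwards [WeightedSpace.toFun_sub (u t) (u t₀), huv t ht0, huv t₀ ht₀'] with x h1 h2 h3
    rw [h1, h2, h3]
  have hae' : (w t - w t₀).toFun =ᵐ[volume] fun x => v t x - v t₀ x := by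
    filter_upwards [WeightedSpace.toFun_sub (w t) (w t₀), hw t ht0, hw t₀ ht₀'] with x h1 h2 h3
    rw [h1, h2, h3]
  have hi1 : Integrable fun x => χ x * ‖v t x - v t₀ x‖ :=
    integrable_smul_of_compactSupport hχc hχcs ((hvt t ht0).sub (hvt t₀ ht₀')).norm
  have hi2 := (hC (u t - u t₀)).1.norm
  have htail : ∫ x, ‖weight (-(k + n + 1)) x • (u t - u t₀).toFun x‖ ≤ D := by
    refine (hC (u t - u t₀)).2.trans ?_
    have h1 : ‖u t - u t₀‖ ≤ 2 * B := by
      have := norm_sub_le (u t) (u t₀)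
      linarith [hut t ht, hut t₀ ht₀m]
    exact mul_le_mul (le_abs_self C) h1 (norm_nonneg _) (abs_nonneg C)
  have hle : ∀ (x : Rn n) (y : Y), ‖weight (-(k + n + 1 + 1)) x • y‖ ≤
      χ x * ‖y‖ + (1 + R)⁻¹ * ‖weight (-(k + n + 1)) x • y‖ := by
    intro x y
    rw [norm_smul, norm_smul, Real.norm_of_nonneg (weight_pos _ x).le,
      Real.norm_of_nonneg (weight_pos _ x).le]
    rcases le_or_gt ‖x‖ R with hx | hx
    · have h1 : weight (-(k + n + 1 + 1)) x ≤ 1 :=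
        Real.rpow_le_one_of_one_le_of_nonpos (by linarith [norm_nonneg x])
          (by linarith [add_natCast_add_one_nonneg n hk])
      rw [hχ1 x hx]
      have h2 := mul_le_mul_of_nonneg_right h1 (norm_nonneg y)
      have h3 := mul_nonneg (by positivity : 0 ≤ (1 + R)⁻¹)
        (mul_nonneg (weight_pos (-(k + n + 1)) x).le (norm_nonneg y))
      linarith
    · have h1 : weight (-(k + n + 1 + 1)) x = (1 + ‖x‖)⁻¹ * weight (-(k + n + 1)) x := by
        rw [neg_add, ← weight_mul_weight, mul_comm]
        simp [weight, Real.rpow_neg_one]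
      have h2 : (1 + ‖x‖)⁻¹ ≤ (1 + R)⁻¹ := by gcongr
      rw [h1, mul_assoc]
      have h3 := mul_le_mul_of_nonneg_right h2
        (mul_nonneg (weight_pos (-(k + n + 1)) x).le (norm_nonneg y))
      linarith [mul_nonneg (hχ0 x) (norm_nonneg y)]
  rw [dist_eq_norm, norm_eq_integral_norm_weight_smul]
  have hint : ∫ x, ‖weight (-(k + n + 1 + 1)) x • (w t - w t₀).toFun x‖ ≤
      ∫ x, (χ x * ‖v t x - v t₀ x‖ +
        (1 + R)⁻¹ * ‖weight (-(k + n + 1)) x • (u t - u t₀).toFun x‖) := by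
    refine integral_mono_of_nonneg (Eventually.of_forall fun x => norm_nonneg _)
      (hi1.add (hi2.const_mul _)) ?_
    filter_upwards [hae, hae'] with x h1 h2
    rw [h1, h2]
    exact hle x _
  rw [integral_add hi1 (hi2.const_mul _), integral_const_mul] at hint
  have hfin : (1 + R)⁻¹ * D ≤ ε / 2 := by
    rw [inv_mul_le_iff₀ (by positivity)]
    have : R * (ε / 2) = D := by
      rw [hR]
      field_simp
    nlinarith
  have := mul_le_mul_of_nonneg_left htail (by positivity : 0 ≤ (1 + R)⁻¹)
  linarith

theorem IsMildSolution.congr {u w : ℝ → WeightedSpace n Y κ k} (hu : IsMildSolution u)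
    (h : ∀ t, 0 ≤ t → w t = u t) : IsMildSolution w := by
  refine ⟨hu.1.congr h, fun t ht => ?_⟩
  have : ∫ s in (0 : ℝ)..t, w s = ∫ s in (0 : ℝ)..t, u s := by
    refine intervalIntegral.integral_congr fun s hs => ?_
    rw [uIcc_of_le ht] at hs
    exact h s hs.1
  rw [this, h t ht, h 0 le_rfl]
  exact hu.2 t ht

variable [CompleteSpace Y]

/-- Away from time zero, a classical solution locally bounded in `wX` is propagated by the heat
semigroup. -/
theorem IsClassicalSolution.eq_heatOp (hk : 0 ≤ k) {v : ℝ → Rn n → Y}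
    (hv : IsClassicalSolution v) {u : ℝ → WeightedSpace n Y κ k}
    (huv : ∀ t, 0 < t → (u t).toFun =ᵐ[volume] v t)
    (hb : ∀ a b : ℝ, 0 < a → a ≤ b → Bornology.IsBounded (u '' Icc a b))
    {a s : ℝ} (ha : 0 < a) (hs : 0 < s) : u (a + s) = heatOp hk s (u a) := by
  have hk' : 0 ≤ k + n + 1 + 1 := by positivity
  have hex : ∀ t, ∃ g : WeightedSpace n Y (.lp 1 le_rfl ENNReal.one_ne_top) (k + n + 1 + 1),
      0 < t → g.toFun =ᵐ[volume] v t := by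
    intro t
    have hi : Integrable fun x => weight (-(k + n + 1 + 1)) x • (u t).toFun x := by
      refine ((u t).integrable_weight_smul).mono
        ((continuous_weight _).aestronglyMeasurable.smul (u t).aestronglyMeasurable_toFun)
        (Eventually.of_forall fun x => ?_)
      rw [norm_smul, norm_smul, Real.norm_of_nonneg (weight_pos _ x).le,
        Real.norm_of_nonneg (weight_pos _ x).le]
      refine mul_le_mul_of_nonneg_right ?_ (norm_nonneg _)
      exact Real.rpow_le_rpow_of_exponent_le (by linarith [norm_nonneg x]) (by linarith)
    obtain ⟨g, hg⟩ := exists_toFun_ae_eq hi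
    exact ⟨g, fun ht => hg.trans (huv t ht)⟩
  -- `w` is `v` as a function with values in the larger space
  choose w hw using hex
  have hwc := continuousOn_weightedL1 hk hv.continuousOn huv hb hw
  have hpair : ∀ (ψ : Rn n → ℝ) (t : ℝ), 0 < t →
      ∫ x, ψ x • (w t).toFun x = ∫ x, ψ x • v t x := fun ψ t ht => by
    refine integral_congr_ae ?_
    filter_upwards [hw t ht] with x hx
    rw [hx]
  have hmild : IsMildSolution fun s => w (a + s) := by
    refine isMildSolution_of_hasDerivAt ?_ fun φ hφ hc t ht => ?_
    · exact hwc.comp (by fun_prop) fun s hs => add_pos_of_pos_of_nonneg ha hs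
    · have hat : 0 < a + t := by positivity
      rw [hpair _ _ hat]
      refine ((hv.hasDerivAt_integral_smul hφ hc hat).comp_const_add a t).congr_of_eventuallyEq ?_
      filter_upwards [eventually_gt_nhds ht] with r hr
      exact hpair φ (a + r) (by positivity)
  have h1 := hmild.eq_heatOp hk' hs.le
  simp only [add_zero] at h1
  have h2 := ((isGaussOrbit_heatOp hk' (w a)).2 s hs).2
  have h3 := ((isGaussOrbit_heatOp hk (u a)).2 s hs).2
  refine WeightedSpace.ext_ae ?_
  have h4 : gaussPoisson s (w a).toFun = gaussPoisson s (u a).toFun :=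
    gaussPoisson_congr_ae ((hw a ha).trans (huv a ha).symm) s
  have has : 0 < a + s := by positivity
  refine (huv _ has).trans ((hw _ has).symm.trans ?_)
  rw [h1]
  refine h2.trans ?_
  rw [h4]
  exact h3.symm

theorem IsClassicalSolution.isMildSolution (hk : 0 ≤ k) {v : ℝ → Rn n → Y}
    (hv : IsClassicalSolution v) {u : ℝ → WeightedSpace n Y κ k}
    (huv : ∀ t, 0 < t → (u t).toFun =ᵐ[volume] v t)
    (hb : ∀ a b : ℝ, 0 < a → a ≤ b → Bornology.IsBounded (u '' Icc a b))
    (hu : Tendsto u (𝓝[>] 0) (𝓝 (u 0))) : IsMildSolution u := by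
  refine (isMildSolution_heatOp hk (u 0)).congr fun t ht => ?_
  rcases ht.eq_or_lt with rfl | ht
  · rw [heatOp_zero]
  -- `u t = G(t - a) u(a)` for small `a > 0`; let `a` tend to zero
  have h1 : Tendsto (fun a => heatOp hk (t - a) (u a)) (𝓝[>] 0) (𝓝 (heatOp hk t (u 0))) := by
    have hsub : Tendsto (fun a : ℝ => t - a) (𝓝[>] 0) (𝓝 t) := by
      have := (continuous_sub_left t).tendsto (0 : ℝ)
      rw [sub_zero] at this
      exact this.mono_left nhdsWithin_le_nhds
    refine tendsto_clm_apply_of_strong (((continuous_heatOp hk (u 0)).tendsto t).comp hsub) ?_ hu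
    obtain ⟨C, hC⟩ := eventually_norm_heatOp_le (n := n) (Y := Y) (κ := κ) hk t
    exact ⟨C, hsub.eventually hC⟩
  have h2 : Tendsto (fun a => heatOp hk (t - a) (u a)) (𝓝[>] 0) (𝓝 (u t)) := by
    refine tendsto_const_nhds.congr' ?_
    filter_upwards [Ioo_mem_nhdsGT ht] with a ha
    have := hv.eq_heatOp hk huv hb ha.1 (sub_pos.2 ha.2)
    rwa [add_sub_cancel] at this
  exact tendsto_nhds_unique h2 h1

end Classical

end WeightedHeat

end

theorem corollary2p2 {Y : Type*} [NormedAddCommGroup Y] [NormedSpace ℂ Y] [CompleteSpace Y]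
    (n : ℕ) (k : ℝ) (hk : 0 ≤ k) (κ : WeightedHeat.SpaceKind) :
    -- every `f` in `wX` gives a mild solution `t ↦ G(t)f`
    (∀ f : WeightedHeat.WeightedSpace n Y κ k,
      ∃ u : ℝ → WeightedHeat.WeightedSpace n Y κ k,
        WeightedHeat.IsMildSolution u ∧ WeightedHeat.IsGaussOrbit u f) ∧
    -- every mild solution is of this form, with the stated regularity
    (∀ u : ℝ → WeightedHeat.WeightedSpace n Y κ k, WeightedHeat.IsMildSolution u →
      ∃ f : WeightedHeat.WeightedSpace n Y κ k,
        WeightedHeat.IsGaussOrbit u f ∧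
        WeightedHeat.IsC1Solution u ∧
        ContDiffOn ℝ ∞
          (fun z : ℝ × WeightedHeat.Rn n => WeightedHeat.gaussPoisson z.1 f.toFun z.2)
          (WeightedHeat.openHalfSpace n) ∧
        WeightedHeat.IsClassicalSolution
          (fun t x => WeightedHeat.gaussPoisson t f.toFun x) ∧
        Tendsto u (𝓝[>] 0) (𝓝 f)) ∧
    -- every classical solution which is a locally bounded function from `(0, ∞)` to `wX` and
    -- converges to `f` in `wX` as `t → 0` defines a mild solution on `[0, ∞)`
    (∀ (v : ℝ → WeightedHeat.Rn n → Y) (u : ℝ → WeightedHeat.WeightedSpace n Y κ k)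
      (f : WeightedHeat.WeightedSpace n Y κ k),
      WeightedHeat.IsClassicalSolution v →
      (∀ t, 0 < t → (u t).toFun =ᵐ[volume] v t) →
      (∀ a b : ℝ, 0 < a → a ≤ b → Bornology.IsBounded (u '' Icc a b)) →
      Tendsto u (𝓝[>] 0) (𝓝 f) →
      u 0 = f →
      WeightedHeat.IsMildSolution u) := by
  open WeightedHeat in
  refine ⟨fun f => ⟨fun t => heatOp hk t f, isMildSolution_heatOp hk f, isGaussOrbit_heatOp hk f⟩,
    fun u hu => ?_, fun v u f hv huv hb hlim h0 => ?_⟩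
  · have heq : ∀ t, 0 ≤ t → u t = heatOp hk t (u 0) := fun t ht => hu.eq_heatOp hk ht
    have hC1 := isC1Solution_heatOp hk (u 0)
    refine ⟨u 0, ⟨rfl, fun t ht => ?_⟩, ⟨?_, fun t ht => ?_⟩,
      contDiffOn_gaussPoisson ((u 0).gaussIntegrable_toFun hk),
      isClassicalSolution_gaussPoisson hk (u 0), ?_⟩
    · rw [heq t ht.le]
      exact (isGaussOrbit_heatOp hk (u 0)).2 t ht
    · exact hC1.1.congr fun t ht => heq t (le_of_lt ht)
    · have he : u =ᶠ[𝓝 t] fun t => heatOp hk t (u 0) := by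
        filter_upwards [eventually_gt_nhds ht] with s hs
        exact heq s hs.le
      rw [he.deriv_eq, heq t ht.le]
      exact hC1.2 t ht
    · exact (hu.1 0 self_mem_Ici).mono_left (nhdsWithin_mono 0 Ioi_subset_Ici_self)
  · rw [← h0] at hlim
    exact hv.isMildSolution hk huv hb hlim
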